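/- Let $D$ be an integral domain with quotient field $K$. An ideal of a domain is called invertible if it is invertible as a fractional ideal (so the zero ideal is not invertible). A domain $R$ is called an MPD domain if it has exactly one ideal $Q$ that is maximal among its non-invertible ideals, and every nonzero non-invertible ideal of $R$ is of the form $JQ$ with $J$ an invertible ideal of $R$. The domain $D$ is called a GMPD domain if every nonzero ideal of $D$ lies in only finitely many maximal ideals, every nonzero prime ideal of $D$ lies in a unique maximal ideal, and $D_M$ is an MPD domain for every maximal ideal $M$ of $D$. A domain $R$ with quotient field $F$ is called a pseudo-valuation domain (PVD) if, for every prime ideal $P$ of $R$ and all $x,y\in F$, $xy\in P$ implies $x\in P$ or $y\in P$; it is called two-generated if each of its ideals can be generated by two elements. A DVR is a valuation domain with value group $\mathbb{Z}$. A quasi-local overring of $D$ is a ring $S$ with $D\subseteq S\subseteq K$ that has exactly one maximal ideal; let $\mathcal{O}_{ql}(D)$ be the set of all of them. **Theorem 2.8.** Let $D$ be a GMPD domain with only finitely many maximal ideals. Let $n_1,n_2,n_3,n_4$ be the numbers of maximal ideals $M$ of $D$ such that $D_M$ is, respectively, a two-generated PVD that is neither a field nor a DVR; a valuation domain with value group $\mathbb{R}$;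 a valuation domain with value group $\mathbb{Z}\times\mathbb{Z}$ (ordered lexicographically); a valuation domain with value group $\mathbb{Z}$. (Value groups are taken up to isomorphism of ordered groups.) Then $\mathcal{O}_{ql}(D)$ is finite and (a) $|\mathcal{O}_{ql}(D)|=2(n_1+n_3)+(n_2+n_4)+1$; (b) $D$ is Noetherian if and only if $|\mathcal{O}_{ql}(D)|=2n_1+n_4+1$; (c) $D$ is Prüfer (every nonzero finitely generated ideal is invertible) if and only if $|\mathcal{O}_{ql}(D)|=2n_3+(n_2+n_4)+1$; (d) $D$ is Dedekind (fields being counted as Dedekind domains) if and only if $|\mathcal{O}_{ql}(D)|=n_4+1$. -/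

import Mathlib

open scoped nonZeroDivisors

/-- An ideal of a domain is invertible if it is a unit in the monoid of fractional ideals. -/
def IsInvertibleIdeal {R : Type*} [CommRing R] [IsDomain R] (I : Ideal R) : Prop :=
  IsUnit (I : FractionalIdeal R⁰ (FractionRing R))

/-- An MNI ideal: an ideal that is maximal among the non-invertible ideals.
The zero ideal counts as a non-invertible ideal. -/
def IsMNI {R : Type*} [CommRing R] [IsDomain R] (Q : Ideal R) : Prop :=
  Maximal (fun I : Ideal R => ¬ IsInvertibleIdeal I) Q

/-- Multiplicatively pinched-Dedekind (MPD) domains: there is a unique MNI ideal `Q`, and each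
nonzero non-invertible ideal is `J * Q` with `J` an invertible (integral) ideal. -/
def IsMPD (R : Type*) [CommRing R] [IsDomain R] : Prop :=
  ∃ Q : Ideal R, IsMNI Q ∧ (∀ Q' : Ideal R, IsMNI Q' → Q' = Q) ∧
    ∀ I : Ideal R, I ≠ ⊥ → ¬ IsInvertibleIdeal I →
      ∃ J : Ideal R, IsInvertibleIdeal J ∧ I = J * Q

/-- h-local domains: each nonzero ideal lies in only finitely many maximal ideals, and each nonzero
prime ideal lies in a unique maximal ideal. -/
def IsHLocal (R : Type*) [CommRing R] [IsDomain R] : Prop :=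
  (∀ I : Ideal R, I ≠ ⊥ → {M : MaximalSpectrum R | I ≤ M.asIdeal}.Finite) ∧
    ∀ P : Ideal R, P.IsPrime → P ≠ ⊥ → ∃! M : MaximalSpectrum R, P ≤ M.asIdeal

/-- Globalized multiplicatively pinched-Dedekind (GMPD) domains: h-local domains all of whose
localizations at maximal ideals are MPD domains. -/
def IsGMPD (R : Type*) [CommRing R] [IsDomain R] : Prop :=
  IsHLocal R ∧ ∀ M : MaximalSpectrum R, IsMPD (Localization.AtPrime M.asIdeal)

/-- Pseudo-valuation domains: each prime ideal `P` is strongly prime, that is, if `x * y ∈ P` with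
`x`, `y` in the quotient field, then `x ∈ P` or `y ∈ P`. -/
def IsPVD (R : Type*) [CommRing R] [IsDomain R] : Prop :=
  ∀ P : Ideal R, P.IsPrime → ∀ x y : FractionRing R,
    x * y ∈ algebraMap R (FractionRing R) '' (P : Set R) →
      x ∈ algebraMap R (FractionRing R) '' (P : Set R) ∨
        y ∈ algebraMap R (FractionRing R) '' (P : Set R)

/-- Each ideal can be generated by two elements. -/
def IsTwoGenerated (R : Type*) [CommRing R] : Prop :=
  ∀ I : Ideal R, ∃ a b : R, I = Ideal.span {a, b}

/-- `R` is a valuation domain whose value group is isomorphic, as an ordered group, to the additive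
ordered group `G`. The value group is the group of units (nonzero elements) of Mathlib's value group
with zero; the multiplicative convention reverses the order, which is immaterial because inversion
is an isomorphism of an ordered abelian group onto its order dual. -/
def IsValuationDomainWithGroup (R : Type*) [CommRing R] [IsDomain R]
    (G : Type*) [AddCommGroup G] [LinearOrder G] : Prop :=
  ∃ _ : ValuationRing R,
    Nonempty ((ValuationRing.ValueGroup R (FractionRing R))ˣ ≃*o Multiplicative G)

/-- A two-generated pseudo-valuation domain that is neither a field nor a DVR (a valuation domain
with value group `ℤ`). -/
def IsTwoGeneratedPVDNotDVR (R : Type*) [CommRing R] [IsDomain R] : Prop :=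
  IsPVD R ∧ IsTwoGenerated R ∧ ¬ IsField R ∧ ¬ IsValuationDomainWithGroup R ℤ

/-- Prüfer domains: each nonzero finitely generated ideal is invertible. -/
def IsPruferDomain (R : Type*) [CommRing R] [IsDomain R] : Prop :=
  ∀ I : Ideal R, I ≠ ⊥ → I.FG → IsInvertibleIdeal I

/-- The quasi-local overrings of `D` in its quotient field `K`: the rings between `D` and `K` that
have exactly one maximal ideal. -/
def quasiLocalOverrings (D K : Type*) [CommRing D] [Field K] [Algebra D K] :
    Set (Subalgebra D K) :=
  {S | IsLocalRing S}

/-! ### Ideals of local MPD domains -/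

section LocalMPD

set_option linter.unusedSectionVars false

variable {R : Type*} [CommRing R] [IsDomain R]

/-! The count reduces to the localizations `D_M`. The maximal ideal of a quasi-local overring `S ≠
K` contracts to a nonzero prime of `D`. By h-locality this prime lies in exactly one maximal ideal
`M`, so `S` is an overring of `D_M` for exactly one `M`. Hence the total is one (for `K`) plus the
sum over `M` of the number of overrings `≠ K` of `D_M`.

For a local MPD domain `R` with maximal ideal `𝔪`, invertible means nonzero principal. If the MNI
ideal `Q` is principal it is zero, and `R` is a field or a DVR (0 or 1 overrings besides `K`).
Otherwise every nonzero nonprincipal ideal is `yQ`, and the method throughout is to exhibit suitable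
nonprincipal ideals and compare them with `Q`.

If `Q ≠ 𝔪`, then `𝔪 = (p)` and `Q` is `πR_Q ∩ R` for some `π`. Every nonzero element of `K` is a
unit times `π^b p^a`, the value group is `ℤ × ℤ`, and the overrings are `R`, `R[1/p]`, `K`
(`IsPinching.exists_rank_two`, `IsRankTwoPair.setOf_subalgebra_ne_top_eq`).

If `Q = 𝔪`, then `𝔪² = x𝔪` for some `x` (`IsPinching.exists_maximalIdeal_mul_self`). For a unit `x`,
`R` is a rank one valuation domain whose value group is all of `ℝ`, and its overrings are `R` and
`K`. For `x ∈ 𝔪`, the ring `W = (𝔪 : 𝔪)` behaves as a DVR with uniformizer `x` and maximal ideal `𝔪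
= xW`. Nothing lies strictly between `R` and `W`, so `R` is a two-generated PVD with overrings `R`,
`W`, `K` (`IsPinchingPVD.setOf_subalgebra_ne_top_eq`).

The types exclude each other, which gives (a). Being Noetherian and being Prüfer are both tested at
the `D_M`: the first means `n₂ = n₃ = 0`, the second `n₁ = 0`, and Dedekind means both. Parts (b),
(c), (d) are then arithmetic. -/

theorem isInvertibleIdeal_iff_of_isLocalRing [IsLocalRing R] {I : Ideal R} :
    IsInvertibleIdeal I ↔ I ≠ ⊥ ∧ I.IsPrincipal := by
  constructor
  · intro h
    refine ⟨?_, ?_⟩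
    · rintro rfl
      rw [IsInvertibleIdeal, FractionalIdeal.coeIdeal_bot] at h
      exact not_isUnit_zero h
    · refine Ideal.IsPrincipal.of_finite_maximals_of_isUnit ?_ h
      refine (Set.finite_singleton (IsLocalRing.maximalIdeal R)).subset ?_
      intro I hI
      exact IsLocalRing.eq_maximalIdeal hI
  · rintro ⟨h0, a, rfl⟩
    have ha : a ≠ 0 := by
      rintro rfl
      exact h0 (by simp)
    rw [IsInvertibleIdeal, ← FractionalIdeal.mul_inv_cancel_iff_isUnit]
    have h1 : ((Ideal.span {a} : Ideal R) : FractionalIdeal R⁰ (FractionRing R)) =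
      FractionalIdeal.spanSingleton R⁰ (algebraMap R (FractionRing R) a) :=
      FractionalIdeal.coeIdeal_span_singleton a
    change ((Ideal.span {a} : Ideal R) : FractionalIdeal R⁰ (FractionRing R)) * _ = 1
    rw [h1]
    apply FractionalIdeal.spanSingleton_mul_inv
    simpa using ha

/-- The ideal `Q` pinches `R`: it is not principal, and each nonzero nonprincipal ideal is a
multiple of it. -/
structure IsPinching (Q : Ideal R) : Prop where
  not_isPrincipal : ¬ Q.IsPrincipal
  exists_eq : ∀ I : Ideal R, I ≠ ⊥ → ¬ I.IsPrincipal → ∃ y : R, y ≠ 0 ∧ I = Ideal.span {y} * Q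

theorem IsPinching.exists_mem_iff {Q : Ideal R} (h : IsPinching Q) {I : Ideal R} (h0 : I ≠ ⊥)
    (hI : ¬ I.IsPrincipal) : ∃ y : R, y ≠ 0 ∧ ∀ r, r ∈ I ↔ ∃ q ∈ Q, y * q = r := by
  obtain ⟨y, hy, rfl⟩ := h.exists_eq I h0 hI
  exact ⟨y, hy, fun r => Ideal.mem_span_singleton_mul⟩

theorem IsPinching.le {Q : Ideal R} (h : IsPinching Q) {I : Ideal R}
    (hI : ¬ I.IsPrincipal) : I ≤ Q := by
  obtain rfl | h0 := eq_or_ne I ⊥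
  · exact bot_le
  · obtain ⟨y, -, rfl⟩ := h.exists_eq I h0 hI
    exact Ideal.mul_le_inf.trans inf_le_right

theorem IsPinching.ne_bot {Q : Ideal R} (h : IsPinching Q) : Q ≠ ⊥ := by
  rintro rfl
  exact h.not_isPrincipal inferInstance

/-- A principal non-invertible `Q` is zero, and so are its multiples; no nonzero nonprincipal ideal
is then left. -/
theorem IsMPD.isPrincipalIdealRing_or_exists_isPinching [IsLocalRing R] (h : IsMPD R) :
    IsPrincipalIdealRing R ∨ ∃ Q : Ideal R, IsPinching Q := by
  obtain ⟨Q, hQ, -, h⟩ := h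
  simp only [isInvertibleIdeal_iff_of_isLocalRing] at h
  by_cases hp : Q.IsPrincipal
  · left
    have hQ0 : Q = ⊥ := by
      by_contra hne
      exact hQ.prop (isInvertibleIdeal_iff_of_isLocalRing.2 ⟨hne, hp⟩)
    subst hQ0
    refine ⟨fun I => ?_⟩
    by_contra hI
    have h0 : I ≠ ⊥ := by
      rintro rfl
      exact hI inferInstance
    obtain ⟨J, -, rfl⟩ := h I h0 fun hh => hI hh.2
    simp at h0
  · refine Or.inr ⟨Q, hp, fun I h0 hI => ?_⟩
    obtain ⟨J, ⟨hJ0, y, rfl⟩, rfl⟩ := h I h0 fun hh => hI hh.2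
    refine ⟨y, ?_, rfl⟩
    rintro rfl
    exact hJ0 (by simp)

/-- The intersection of the powers of a principal ideal. -/
def iInfPow (a : R) : Ideal R := ⨅ n : ℕ, Ideal.span {a ^ n}

theorem mem_iInfPow {a r : R} : r ∈ iInfPow a ↔ ∀ n : ℕ, a ^ n ∣ r := by
  simp [iInfPow, Ideal.mem_span_singleton]

theorem mul_mem_iInfPow_iff {a r : R} (ha : a ≠ 0) : a * r ∈ iInfPow a ↔ r ∈ iInfPow a := by
  refine ⟨fun h => mem_iInfPow.2 fun n => ?_, fun h => Ideal.mul_mem_left _ _ h⟩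
  have := mem_iInfPow.1 h (n + 1)
  rw [pow_succ'] at this
  exact (mul_dvd_mul_iff_left ha).1 this

/-- A nonzero ideal all of whose elements are divisible, inside the ideal, by a fixed nonunit is
not principal. -/
theorem not_isPrincipal_of_dvd {I : Ideal R} (h0 : I ≠ ⊥) {a : R} (ha : ¬ IsUnit a)
    (h : ∀ r ∈ I, ∃ s ∈ I, r = a * s) : ¬ I.IsPrincipal := by
  rintro ⟨c, rfl⟩
  have hc : c ≠ 0 := by
    rintro rfl
    exact h0 (by simp)
  obtain ⟨s, hs, hcs⟩ := h c (Submodule.mem_span_singleton_self c)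
  obtain ⟨t, rfl⟩ := Submodule.mem_span_singleton.1 hs
  refine ha (IsUnit.of_mul_eq_one t (mul_left_cancel₀ hc ?_))
  rw [smul_eq_mul] at hcs
  linear_combination -hcs

theorem not_isPrincipal_iInfPow {a : R} (ha0 : a ≠ 0) (ha : ¬ IsUnit a) (h0 : iInfPow a ≠ ⊥) :
    ¬ (iInfPow a).IsPrincipal := by
  refine not_isPrincipal_of_dvd h0 ha fun r hr => ?_
  obtain ⟨s, rfl⟩ := mem_iInfPow.1 hr 1
  rw [pow_one] at hr ⊢
  exact ⟨s, (mul_mem_iInfPow_iff ha0).1 hr, rfl⟩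

theorem IsPinching.iInfPow_le {Q : Ideal R} (h : IsPinching Q) {a : R} (ha0 : a ≠ 0)
    (ha : ¬ IsUnit a) : iInfPow a ≤ Q := by
  obtain h0 | h0 := eq_or_ne (iInfPow a) ⊥
  · simp [h0]
  · exact h.le (not_isPrincipal_iInfPow ha0 ha h0)

/-- An ideal `I` with `a * r ∈ I → r ∈ I` for an element `a` of `Q` vanishes, if it is zero or
nonprincipal. -/
theorem IsPinching.eq_bot_of_mul_mem {Q : Ideal R} (h : IsPinching Q) (hQ : Q ≠ ⊤) {a : R}
    (haQ : a ∈ Q) {I : Ideal R} (hI : I ≠ ⊥ → ¬ I.IsPrincipal) (hmul : ∀ r, a * r ∈ I → r ∈ I) :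
    I = ⊥ := by
  by_contra h0
  obtain ⟨y, hy, hm⟩ := h.exists_mem_iff h0 (hI h0)
  -- If `I = yQ`, then `ay ∈ I`, so `y ∈ I = yQ` and `1 ∈ Q`.
  have hyI : y ∈ I := hmul y ((hm _).2 ⟨a, haQ, mul_comm _ _⟩)
  obtain ⟨q, hq, hyq⟩ := (hm y).1 hyI
  have : q = 1 := mul_left_cancel₀ hy (by rw [hyq, mul_one])
  exact hQ ((Ideal.eq_top_iff_one Q).2 (this ▸ hq))

theorem IsPinching.ne_top {Q : Ideal R} (h : IsPinching Q) : Q ≠ ⊤ := by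
  rintro rfl
  exact h.not_isPrincipal inferInstance

/-- A substitute for Krull's intersection theorem, valid without any Noetherian hypothesis. -/
theorem IsPinching.iInfPow_eq_bot {Q : Ideal R} (h : IsPinching Q) {a : R} (ha0 : a ≠ 0)
    (haQ : a ∈ Q) : iInfPow a = ⊥ :=
  h.eq_bot_of_mul_mem h.ne_top haQ
    (not_isPrincipal_iInfPow ha0 fun hu => h.ne_top (Ideal.eq_top_of_isUnit_mem _ haQ hu))
    fun _ => (mul_mem_iInfPow_iff ha0).1

/-- If the maximal ideal is `(p)`, an element outside `⋂ (pⁿ)` is a unit times a power of `p`. -/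
theorem exists_eq_unit_mul_pow [IsLocalRing R] {p r : R}
    (hp : IsLocalRing.maximalIdeal R = Ideal.span {p}) (hr : r ∉ iInfPow p) :
    ∃ (u : Rˣ) (n : ℕ), r = u * p ^ n := by
  rw [mem_iInfPow] at hr
  push Not at hr
  classical
  have hn0 : Nat.find hr ≠ 0 := fun h0 => Nat.find_spec hr (by rw [h0]; simp)
  obtain ⟨n, hn⟩ := Nat.exists_eq_succ_of_ne_zero hn0
  have h1 : p ^ n ∣ r := not_not.1 (Nat.find_min hr (by omega))
  have h2 := Nat.find_spec hr
  rw [hn] at h2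
  obtain ⟨s, rfl⟩ := h1
  have hs : IsUnit s := by
    by_contra hs
    have : s ∈ Ideal.span {p} := hp ▸ (IsLocalRing.mem_maximalIdeal s).2 hs
    obtain ⟨t, rfl⟩ := Ideal.mem_span_singleton.1 this
    exact h2 ⟨t, by rw [pow_succ]; ring⟩
  exact ⟨hs.unit, n, by simp [mul_comm]⟩

/-- The elements outside `Q` are units times powers of `p`, so `R_Q = R[1/p]`. An ideal contracted
from `R_Q` and contained in `Q` is `p`-divisible, hence nonprincipal if nonzero. Applied to `xR_Q ∩
R` this makes `Q` locally generated by some `π`; applied to `⋂ πⁿR_Q ∩ R` it makes that intersection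
zero, so each nonzero element has a finite `π`-order. -/
theorem IsPinching.exists_rank_two [IsLocalRing R] {Q : Ideal R} (h : IsPinching Q)
    (hM : IsLocalRing.maximalIdeal R ≠ Q) :
    ∃ p π : R, IsLocalRing.maximalIdeal R = Ideal.span {p} ∧ p ≠ 0 ∧ π ≠ 0 ∧
      (∀ n : ℕ, p ^ n ∣ π) ∧
      ∀ r : R, r ≠ 0 → ∃ (n a b : ℕ) (u : Rˣ), p ^ n * r = u * p ^ a * π ^ b := by
  have hQM : Q ≤ IsLocalRing.maximalIdeal R := IsLocalRing.le_maximalIdeal h.ne_top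
  have hMp : (IsLocalRing.maximalIdeal R).IsPrincipal := by
    by_contra hp
    exact hM (le_antisymm (h.le hp) hQM)
  obtain ⟨p, hp⟩ := hMp
  rw [Ideal.submodule_span_eq] at hp
  have hp0 : p ≠ 0 := by
    rintro rfl
    refine h.ne_bot (le_bot_iff.1 (hQM.trans ?_))
    simp [hp]
  have hpu : ¬ IsUnit p := by
    rw [← mem_nonunits_iff, ← IsLocalRing.mem_maximalIdeal, hp]
    exact Ideal.mem_span_singleton_self p
  have hdiv : ∀ q ∈ Q, ∃ r, q = p * r := fun q hq =>
    Ideal.mem_span_singleton.1 (hp ▸ hQM hq)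
  -- `Q` is saturated with respect to `p`
  have hsat : ∀ r, p * r ∈ Q → r ∈ Q := by
    let Q' : Ideal R := Submodule.comap (LinearMap.mulLeft R p) Q
    have hQ' : ∀ r, r ∈ Q' ↔ p * r ∈ Q := fun r => Iff.rfl
    -- Since `Q ⊆ (p)`, `Q = pQ'`; a generator `c` of `Q'` would give the generator `pc` of `Q`.
    have hnp : ¬ Q'.IsPrincipal := by
      rintro ⟨c, hc⟩
      apply h.not_isPrincipal
      refine ⟨p * c, le_antisymm (fun q hq => ?_) ?_⟩
      · obtain ⟨r, rfl⟩ := hdiv q hq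
        have : r ∈ Q' := hq
        rw [hc] at this
        obtain ⟨t, rfl⟩ := Submodule.mem_span_singleton.1 this
        exact Submodule.mem_span_singleton.2 ⟨t, by simp only [smul_eq_mul]; ring⟩
      · rw [Submodule.span_singleton_le_iff_mem, ← hQ', hc]
        exact Submodule.mem_span_singleton_self c
    exact fun r hr => h.le hnp hr
  have hsatn : ∀ (n : ℕ) r, p ^ n * r ∈ Q → r ∈ Q := by
    intro n
    induction n with
    | zero => simp
    | succ n ih =>
      intro r hr
      exact ih r (hsat _ (by rwa [pow_succ', mul_assoc] at hr))
  have hpn : ∀ q ∈ Q, ∀ n : ℕ, ∃ r ∈ Q, q = p ^ n * r := by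
    intro q hq n
    induction n with
    | zero => exact ⟨q, hq, by simp⟩
    | succ n ih =>
      obtain ⟨r, hr, rfl⟩ := ih
      obtain ⟨s, rfl⟩ := hdiv r hr
      exact ⟨s, hsat s hr, by ring⟩
  have hnotQ : ∀ r ∉ Q, ∃ (u : Rˣ) (n : ℕ), r = u * p ^ n := fun r hr =>
    exists_eq_unit_mul_pow hp fun hh => hr (h.iInfPow_le hp0 hpu hh)
  obtain ⟨x, hxQ, hx0⟩ := Submodule.exists_mem_ne_zero_of_ne_bot h.ne_bot
  -- the ideal `x R_Q`
  let I : Ideal R :=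
    { carrier := {r | ∃ n : ℕ, x ∣ p ^ n * r}
      zero_mem' := ⟨0, by simp⟩
      add_mem' := by
        rintro a b ⟨m, hm⟩ ⟨n, hn⟩
        refine ⟨m + n, ?_⟩
        have : p ^ (m + n) * (a + b) = p ^ n * (p ^ m * a) + p ^ m * (p ^ n * b) := by ring
        rw [this]
        exact dvd_add (hm.mul_left _) (hn.mul_left _)
      smul_mem' := by
        rintro c a ⟨m, hm⟩
        refine ⟨m, ?_⟩
        rw [smul_eq_mul, mul_left_comm]
        exact hm.mul_left _ }
  have hI : ∀ r, r ∈ I ↔ ∃ n : ℕ, x ∣ p ^ n * r := fun r => Iff.rfl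
  have hxI : x ∈ I := ⟨0, by simp⟩
  have hI0 : I ≠ ⊥ := fun hh => hx0 (by rw [hh] at hxI; simpa using hxI)
  have hIQ : I ≤ Q := by
    rintro r ⟨n, t, ht⟩
    exact hsatn n r (ht ▸ Ideal.mul_mem_right _ _ hxQ)
  have hInp : ¬ I.IsPrincipal := by
    refine not_isPrincipal_of_dvd hI0 hpu fun r hr => ?_
    obtain ⟨s, rfl⟩ := hdiv r (hIQ hr)
    obtain ⟨n, hn⟩ := hr
    exact ⟨s, ⟨n + 1, by rwa [pow_succ, mul_assoc]⟩, rfl⟩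
  -- Cancelling `y` in `xR_Q ∩ R = yQ`, with `x = yπ`, shows that `Q = πR_Q ∩ R`.
  obtain ⟨y, hy, hyI⟩ := h.exists_mem_iff hI0 hInp
  obtain ⟨π, hπQ, rfl⟩ := (hyI x).1 hxI
  have hπ0 : π ≠ 0 := right_ne_zero_of_mul hx0
  have hQπ : ∀ q ∈ Q, ∃ n : ℕ, π ∣ p ^ n * q := by
    intro q hq
    obtain ⟨n, hn⟩ := (hI _).1 ((hyI (y * q)).2 ⟨q, hq, rfl⟩)
    rw [mul_left_comm] at hn
    exact ⟨n, (mul_dvd_mul_iff_left hy).1 hn⟩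
  -- the ideal `⋂ πⁿ R_Q`
  let P : Ideal R :=
    { carrier := {r | ∀ b : ℕ, ∃ n : ℕ, π ^ b ∣ p ^ n * r}
      zero_mem' := fun b => ⟨0, by simp⟩
      add_mem' := by
        intro a b ha hb k
        obtain ⟨m, hm⟩ := ha k
        obtain ⟨n, hn⟩ := hb k
        refine ⟨m + n, ?_⟩
        have : p ^ (m + n) * (a + b) = p ^ n * (p ^ m * a) + p ^ m * (p ^ n * b) := by ring
        rw [this]
        exact dvd_add (hm.mul_left _) (hn.mul_left _)
      smul_mem' := by
        intro c a ha k
        obtain ⟨m, hm⟩ := ha k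
        refine ⟨m, ?_⟩
        rw [smul_eq_mul, mul_left_comm]
        exact hm.mul_left _ }
  have hP : ∀ r, r ∈ P ↔ ∀ b : ℕ, ∃ n : ℕ, π ^ b ∣ p ^ n * r := fun r => Iff.rfl
  have hPQ : P ≤ Q := by
    intro r hr
    obtain ⟨n, t, ht⟩ := hr 1
    exact hsatn n r (ht ▸ Ideal.mul_mem_right _ _ (by simpa using hπQ))
  have hP0 : P = ⊥ := by
    refine h.eq_bot_of_mul_mem h.ne_top hπQ (fun h0 => ?_) fun r hr b => ?_
    · refine not_isPrincipal_of_dvd h0 hpu fun r hr => ?_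
      obtain ⟨s, rfl⟩ := hdiv r (hPQ hr)
      refine ⟨s, fun b => ?_, rfl⟩
      obtain ⟨n, hn⟩ := hr b
      exact ⟨n + 1, by rwa [pow_succ, mul_assoc]⟩
    · obtain ⟨n, hn⟩ := hr (b + 1)
      rw [mul_left_comm, pow_succ'] at hn
      exact ⟨n, (mul_dvd_mul_iff_left hπ0).1 hn⟩
  refine ⟨p, π, hp, hp0, hπ0, fun n => ?_, fun r hr => ?_⟩
  · obtain ⟨r, -, hr⟩ := hpn π hπQ n
    exact ⟨r, hr⟩
  · have hrP : ¬ ∀ b : ℕ, ∃ n : ℕ, π ^ b ∣ p ^ n * r := fun hh => hr (by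
      have : r ∈ P := hh
      rw [hP0] at this
      simpa using this)
    push Not at hrP
    classical
    -- The exponent `b` is the largest with `r ∈ π^b R_Q`; the cofactor `s` then avoids `Q`.
    have hn0 : Nat.find hrP ≠ 0 := fun h0 => Nat.find_spec hrP 0 (by rw [h0]; simp)
    obtain ⟨b, hb⟩ := Nat.exists_eq_succ_of_ne_zero hn0
    have h1 : ∃ n : ℕ, π ^ b ∣ p ^ n * r := by
      have := Nat.find_min hrP (m := b) (by omega)
      push Not at this
      exact this
    have h2 := Nat.find_spec hrP
    rw [hb] at h2
    obtain ⟨n, s, hs⟩ := h1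
    have hsQ : s ∉ Q := by
      intro hsQ
      obtain ⟨m, t, ht⟩ := hQπ s hsQ
      refine h2 (m + n) ⟨t, ?_⟩
      rw [pow_add, mul_assoc, hs, mul_left_comm, ht, pow_succ]
      ring
    obtain ⟨u, a, rfl⟩ := hnotQ s hsQ
    exact ⟨n, a, b, u, by rw [hs]; ring⟩

end LocalMPD

/-! ### Overrings of valuation domains -/

section Overrings

set_option linter.unusedSectionVars false

variable {R K : Type*} [CommRing R] [IsDomain R] [Field K] [Algebra R K]

theorem Subalgebra.isLocalRing_of_mem_or_inv_mem (S : Subalgebra R K)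
    (h : ∀ k : K, k ∈ S ∨ k⁻¹ ∈ S) : IsLocalRing S := by
  have hunit : ∀ a : S, IsUnit a ↔ (a : K) ≠ 0 ∧ (a : K)⁻¹ ∈ S := by
    intro a
    constructor
    · rintro ⟨u, rfl⟩
      have h1 : ((u : S) : K) * ((u⁻¹ : Sˣ) : S) = 1 := by
        rw [← MulMemClass.coe_mul, Units.mul_inv, OneMemClass.coe_one]
      refine ⟨left_ne_zero_of_mul_eq_one h1, ?_⟩
      rw [inv_eq_of_mul_eq_one_right h1]
      exact SetLike.coe_mem _
    · rintro ⟨h0, hi⟩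
      exact IsUnit.of_mul_eq_one ⟨_, hi⟩ (Subtype.ext (mul_inv_cancel₀ h0))
  refine IsLocalRing.of_nonunits_add ?_
  -- If `a / b ∈ S`, then `a + b = (a / b + 1) b` is a multiple of `b`.
  have key : ∀ a b : S, a ∈ nonunits S → (a : K) / b ∈ S → IsUnit (a + b) → IsUnit b := by
    intro a b ha hab hu
    obtain hb0 | hb0 := eq_or_ne (b : K) 0
    · have : b = 0 := Subtype.ext hb0
      rw [this, add_zero] at hu
      exact absurd hu ha
    have : a + b = (⟨_, hab⟩ + 1) * b := Subtype.ext (by simp [add_mul, div_mul_cancel₀ _ hb0])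
    rw [this] at hu
    exact isUnit_of_mul_isUnit_right hu
  intro a b ha hb hab
  rcases h ((a : K) / b) with h1 | h1
  · exact hb (key a b ha h1 hab)
  · rw [inv_div] at h1
    exact ha (key b a hb h1 (by rwa [add_comm]))

theorem Subalgebra.isLocalRing_bot [IsLocalRing R] :
    IsLocalRing (⊥ : Subalgebra R K) := by
  refine IsLocalRing.of_surjective' (algebraMap R (⊥ : Subalgebra R K)) ?_
  rintro ⟨x, hx⟩
  obtain ⟨r, rfl⟩ := Algebra.mem_bot.1 hx
  exact ⟨r, rfl⟩

variable [IsFractionRing R K]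

theorem ValuationRing.mem_bot_or_inv_mem_bot [ValuationRing R] (k : K) :
    k ∈ (⊥ : Subalgebra R K) ∨ k⁻¹ ∈ (⊥ : Subalgebra R K) := by
  simp only [Algebra.mem_bot]
  exact ValuationRing.isInteger_or_isInteger R k

theorem Subalgebra.isLocalRing_of_valuationRing [ValuationRing R] (S : Subalgebra R K) :
    IsLocalRing S := by
  refine S.isLocalRing_of_mem_or_inv_mem fun k => ?_
  exact (ValuationRing.mem_bot_or_inv_mem_bot (R := R) k).imp (fun h => bot_le (a := S) h)
    fun h => bot_le (a := S) h

theorem Subalgebra.eq_top_of_forall_inv_mem (S : Subalgebra R K)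
    (h : ∀ b : R, b ≠ 0 → (algebraMap R K b)⁻¹ ∈ S) : S = ⊤ := by
  refine eq_top_iff.2 fun k _ => ?_
  obtain ⟨a, b, hb, rfl⟩ := IsFractionRing.div_surjective (A := R) k
  rw [div_eq_mul_inv]
  exact S.mul_mem (S.algebraMap_mem a) (h b (nonZeroDivisors.ne_zero hb))

theorem Subalgebra.inv_mem_of_dvd (S : Subalgebra R K) {a b : R} (hab : b ∣ a) (ha0 : a ≠ 0)
    (ha : (algebraMap R K a)⁻¹ ∈ S) : (algebraMap R K b)⁻¹ ∈ S := by
  obtain ⟨c, rfl⟩ := hab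
  have hc : algebraMap R K c ≠ 0 := by
    simpa using right_ne_zero_of_mul ha0
  have : (algebraMap R K b)⁻¹ = algebraMap R K c * (algebraMap R K (b * c))⁻¹ := by
    rw [map_mul, mul_inv, mul_left_comm, mul_inv_cancel₀ hc, mul_one]
  rw [this]
  exact S.mul_mem (S.algebraMap_mem c) ha

theorem Subalgebra.bot_ne_top_of_not_isField (hf : ¬ IsField R) :
    (⊥ : Subalgebra R K) ≠ ⊤ := by
  intro h
  apply hf
  refine ⟨⟨0, 1, zero_ne_one⟩, mul_comm, fun {a} ha => ?_⟩
  have : (algebraMap R K a)⁻¹ ∈ (⊥ : Subalgebra R K) := h ▸ Algebra.mem_top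
  obtain ⟨b, hb⟩ := Algebra.mem_bot.1 this
  refine ⟨b, IsFractionRing.injective R K ?_⟩
  rw [map_mul, hb, map_one, mul_inv_cancel₀]
  simpa using ha

/-- A rank one valuation domain has no proper overrings besides its quotient field. -/
theorem ValuationRing.setOf_subalgebra_ne_top_eq [ValuationRing R] (hf : ¬ IsField R)
    (harch : ∀ a : R, ¬ IsUnit a → ∀ b : R, b ≠ 0 → ∃ n : ℕ, b ∣ a ^ n) :
    {S : Subalgebra R K | S ≠ ⊤} = {⊥} := by
  ext S
  simp only [Set.mem_ofPred_eq, Set.mem_singleton_iff]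
  constructor
  · intro hS
    by_contra hb
    apply hS
    obtain ⟨s, hsS, hs⟩ := SetLike.exists_of_lt (bot_lt_iff_ne_bot.2 hb)
    obtain ⟨a, ha⟩ := Algebra.mem_bot.1
      ((ValuationRing.mem_bot_or_inv_mem_bot (R := R) s).resolve_left hs)
    have hau : ¬ IsUnit a := by
      rintro ⟨u, rfl⟩
      refine hs (Algebra.mem_bot.2 ⟨(u⁻¹ : Rˣ), ?_⟩)
      rw [← inv_inv s, ← ha, ← map_units_inv]
    refine S.eq_top_of_forall_inv_mem fun b hb => ?_
    -- Here `s = 1 / a`; as `b` divides `aⁿ`, the inverse of `b` is an `R`-multiple of `sⁿ`.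
    obtain ⟨n, hn⟩ := harch a hau b hb
    have ha0 : a ≠ 0 := by
      rintro rfl
      rw [map_zero, eq_comm, inv_eq_zero] at ha
      exact hs (ha ▸ zero_mem _)
    refine S.inv_mem_of_dvd hn (pow_ne_zero _ ha0) ?_
    rw [map_pow, ← inv_pow, ha, inv_inv]
    exact S.pow_mem hsS n
  · rintro rfl
    exact Subalgebra.bot_ne_top_of_not_isField hf

end Overrings

/-! ### Identification of value groups -/

section ValueGroup

theorem ValuationRing.valuation_surjective (R K : Type*) [CommRing R] [IsDomain R] [Field K]
    [Algebra R K] [IsFractionRing R K] [ValuationRing R] :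
    Function.Surjective (ValuationRing.valuation R K) :=
  Quotient.mk''_surjective

/-- A homomorphic section `φ` of the value map determines the value group: every nonzero `k` is a
unit times some `φ g`, and integrality of `φ g` recovers the order. -/
theorem isValuationDomainWithGroup_of_parametrization {R : Type*} [CommRing R] [IsDomain R]
    {G : Type*} [AddCommGroup G] [LinearOrder G] [IsOrderedAddMonoid G]
    (φ : Multiplicative G →* FractionRing R)
    (hmem : ∀ g : G, (∃ r, algebraMap R (FractionRing R) r = φ (.ofAdd g)) ↔ 0 ≤ g)
    (hsurj : ∀ k : FractionRing R, k ≠ 0 →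
      ∃ (g : G) (u : Rˣ), k = algebraMap R (FractionRing R) u * φ (.ofAdd g)) :
    IsValuationDomainWithGroup R G := by
  set K := FractionRing R
  have hval : ValuationRing R := by
    rw [ValuationRing.iff_isInteger_or_isInteger R K]
    intro k
    obtain rfl | hk := eq_or_ne k 0
    · exact Or.inl ⟨0, map_zero _⟩
    obtain ⟨g, u, rfl⟩ := hsurj k hk
    rcases le_total 0 g with h | h
    · obtain ⟨r, hr⟩ := (hmem g).2 h
      exact Or.inl ⟨u * r, by rw [map_mul, hr]⟩
    · obtain ⟨r, hr⟩ := (hmem (-g)).2 (neg_nonneg.2 h)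
      refine Or.inr ⟨(u⁻¹ : Rˣ) * r, ?_⟩
      rw [map_mul, hr, mul_inv, map_units_inv, ofAdd_neg, map_inv]
  refine ⟨hval, ?_⟩
  let v := ValuationRing.valuation R K
  -- Integral elements have multiplicative value `≤ 1` but additive value `≥ 0`; inversion
  -- reconciles the two orders.
  let f : Multiplicative G →* (ValuationRing.ValueGroup R K)ˣ :=
    (Units.map (v : K →* ValuationRing.ValueGroup R K)).comp
      (φ.toHomUnits.comp (invMonoidHom : Multiplicative G →* Multiplicative G))
  have hf : ∀ g : Multiplicative G, (f g : ValuationRing.ValueGroup R K) = v (φ g⁻¹) :=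
    fun g => rfl
  have hone : ∀ g : Multiplicative G, f g ≤ 1 ↔ g ≤ 1 := by
    intro g
    rw [← Units.val_le_val, hf, Units.val_one]
    have := ValuationRing.mem_integer_iff R K (φ g⁻¹)
    rw [Valuation.mem_integer_iff] at this
    rw [this]
    have h2 := hmem (Multiplicative.toAdd g⁻¹)
    rw [ofAdd_toAdd] at h2
    rw [h2, toAdd_inv, neg_nonneg]
    rfl
  have hle : ∀ g h : Multiplicative G, f g ≤ f h ↔ g ≤ h := by
    intro g h
    rw [← div_le_one', ← map_div, hone, div_le_one']
  have hinj : Function.Injective f := fun g h hgh =>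
    le_antisymm ((hle g h).1 hgh.le) ((hle h g).1 hgh.ge)
  have hsur : Function.Surjective f := by
    intro y
    obtain ⟨k, hk⟩ := ValuationRing.valuation_surjective R K (y : ValuationRing.ValueGroup R K)
    have hk0 : k ≠ 0 := by
      rintro rfl
      rw [map_zero] at hk
      exact y.ne_zero hk.symm
    obtain ⟨g, u, rfl⟩ := hsurj k hk0
    refine ⟨(Multiplicative.ofAdd g)⁻¹, Units.ext ?_⟩
    rw [hf, inv_inv, ← hk]
    rw [map_mul]
    have : ValuationRing.valuation R K (algebraMap R K u) = 1 := by
      refine le_antisymm ((ValuationRing.mem_integer_iff R K _).2 ⟨u, rfl⟩) ?_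
      rw [← inv_le_one₀ (by
        rw [zero_lt_iff]
        simp), ← map_inv₀, ← map_units_inv]
      exact (ValuationRing.mem_integer_iff R K _).2 ⟨_, rfl⟩
    rw [this, one_mul]
  exact ⟨(OrderMonoidIso.mk (MulEquiv.ofBijective f ⟨hinj, hsur⟩) (fun {a b} => hle a b)).symm⟩

end ValueGroup

/-! ### Discrete valuation rings -/

section Discrete

variable {R : Type*} [CommRing R] [IsDomain R]

theorem IsDiscreteValuationRing.isValuationDomainWithGroup_int [IsDiscreteValuationRing R] :
    IsValuationDomainWithGroup R ℤ := by
  obtain ⟨π, hπ⟩ := IsDiscreteValuationRing.exists_irreducible R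
  set K := FractionRing R
  have hπ0 : algebraMap R K π ≠ 0 := by simpa using hπ.ne_zero
  let φ : Multiplicative ℤ →* K := (Units.coeHom K).comp (zpowersHom Kˣ (Units.mk0 _ hπ0))
  have hφ : ∀ n : ℤ, φ (.ofAdd n) = algebraMap R K π ^ n := fun n => by simp [φ]
  refine isValuationDomainWithGroup_of_parametrization φ (fun n => ?_) fun k hk => ?_
  · rw [hφ]
    constructor
    · rintro ⟨r, hr⟩
      by_contra! hn
      obtain ⟨m, rfl⟩ : ∃ m : ℕ, n = -((m + 1 : ℕ) : ℤ) := ⟨(-n - 1).toNat, by omega⟩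
      have h1 : r * π ^ (m + 1) = 1 := by
        apply IsFractionRing.injective R K
        rw [map_mul, hr, zpow_neg, zpow_natCast, map_pow, map_one,
          inv_mul_cancel₀ (pow_ne_zero _ hπ0)]
      exact hπ.not_isUnit (IsUnit.of_mul_eq_one (r * π ^ m) (by rw [← h1]; ring))
    · intro hn
      lift n to ℕ using hn
      exact ⟨π ^ n, (map_pow _ _ _).trans (zpow_natCast _ _).symm⟩
  · obtain ⟨a, b, hb, rfl⟩ := IsFractionRing.div_surjective (A := R) k
    have hb0 := nonZeroDivisors.ne_zero hb
    have ha0 : a ≠ 0 := by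
      rintro rfl
      simp at hk
    obtain ⟨m, u, rfl⟩ := IsDiscreteValuationRing.eq_unit_mul_pow_irreducible ha0 hπ
    obtain ⟨n, v, rfl⟩ := IsDiscreteValuationRing.eq_unit_mul_pow_irreducible hb0 hπ
    refine ⟨(m : ℤ) - n, u * v⁻¹, ?_⟩
    rw [hφ, zpow_sub₀ hπ0]
    simp only [map_mul, map_pow, Units.val_mul, map_units_inv, zpow_natCast]
    rw [mul_div_mul_comm, div_eq_mul_inv (algebraMap R _ _)]

theorem IsDiscreteValuationRing.exists_dvd_pow [IsDiscreteValuationRing R] (a : R)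
    (ha : ¬ IsUnit a) (b : R) (hb : b ≠ 0) : ∃ n : ℕ, b ∣ a ^ n := by
  obtain ⟨π, hπ⟩ := IsDiscreteValuationRing.exists_irreducible R
  obtain ⟨m, u, rfl⟩ := IsDiscreteValuationRing.eq_unit_mul_pow_irreducible hb hπ
  have : a ∈ IsLocalRing.maximalIdeal R := (IsLocalRing.mem_maximalIdeal a).2 ha
  rw [hπ.maximalIdeal_eq] at this
  obtain ⟨c, rfl⟩ := Ideal.mem_span_singleton.1 this
  refine ⟨m, ?_⟩
  rw [mul_pow, Units.mul_left_dvd]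
  exact dvd_mul_right _ _

end Discrete

/-! ### Rank two: value group `ℤ × ℤ` -/

section RankTwo

set_option linter.unusedSectionVars false

variable {R : Type*} [CommRing R] [IsDomain R]

/-- A domain whose nonzero elements are, up to units and quotients by powers of `p`, the products
of powers of `p` and `π`, where `π` is divisible by all the powers of `p`. -/
structure IsRankTwoPair (p π : R) : Prop where
  left_ne_zero : p ≠ 0
  right_ne_zero : π ≠ 0
  not_isUnit : ¬ IsUnit p
  pow_dvd : ∀ n : ℕ, p ^ n ∣ π
  exists_eq : ∀ r : R, r ≠ 0 → ∃ (n a b : ℕ) (u : Rˣ), p ^ n * r = u * p ^ a * π ^ b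

variable {p π : R} {K : Type*} [Field K] [Algebra R K] [IsFractionRing R K]

theorem IsRankTwoPair.exists_eq_zpow (h : IsRankTwoPair p π) (k : K) (hk : k ≠ 0) :
    ∃ (b a : ℤ) (u : Rˣ),
      k = algebraMap R K u * (algebraMap R K π ^ b * algebraMap R K p ^ a) := by
  have hp0 : algebraMap R K p ≠ 0 := by simpa using h.left_ne_zero
  have hπ0 : algebraMap R K π ≠ 0 := by simpa using h.right_ne_zero
  have key : ∀ r : R, r ≠ 0 → ∃ (b a : ℤ) (u : Rˣ), algebraMap R K r =
      algebraMap R K u * (algebraMap R K π ^ b * algebraMap R K p ^ a) := by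
    intro r hr
    obtain ⟨n, a, b, u, hu⟩ := h.exists_eq r hr
    refine ⟨b, a - n, u, ?_⟩
    have := congrArg (algebraMap R K) hu
    simp only [map_mul, map_pow] at this
    rw [zpow_sub₀ hp0, zpow_natCast, zpow_natCast, zpow_natCast]
    field_simp
    linear_combination this
  obtain ⟨a, b, hb, rfl⟩ := IsFractionRing.div_surjective (A := R) k
  have ha0 : a ≠ 0 := by
    rintro rfl
    simp at hk
  obtain ⟨b₁, a₁, u, hu⟩ := key a ha0
  obtain ⟨b₂, a₂, v, hv⟩ := key b (nonZeroDivisors.ne_zero hb)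
  refine ⟨b₁ - b₂, a₁ - a₂, u * v⁻¹, ?_⟩
  rw [hu, hv, zpow_sub₀ hp0, zpow_sub₀ hπ0, Units.val_mul, map_mul, map_units_inv]
  have : algebraMap R K v ≠ 0 := by simp
  field_simp

/-- The factor `p` records that a lexicographically positive monomial is a nonunit, which is what
excludes negative monomials from `R` afterwards. -/
theorem IsRankTwoPair.exists_eq_zpow_of_pos (h : IsRankTwoPair p π) {b a : ℤ}
    (hab : 0 < b ∨ b = 0 ∧ 0 < a) :
    ∃ r : R, algebraMap R K (p * r) = algebraMap R K π ^ b * algebraMap R K p ^ a := by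
  have hp0 : algebraMap R K p ≠ 0 := by simpa using h.left_ne_zero
  have hπ0 : algebraMap R K π ≠ 0 := by simpa using h.right_ne_zero
  rcases hab with hb | ⟨rfl, ha⟩
  · obtain ⟨m, rfl⟩ : ∃ m : ℕ, b = m + 1 := ⟨(b - 1).toNat, by omega⟩
    -- One factor `π = pⁿs` supplies enough powers of `p` to absorb `p^a` and still leave one `p`
    -- over.
    obtain ⟨n, hn⟩ : ∃ n : ℕ, 0 ≤ n + a - 1 := ⟨(1 - a).toNat, by omega⟩
    obtain ⟨l, hl⟩ : ∃ l : ℕ, n + a - 1 = l := ⟨_, (Int.toNat_of_nonneg hn).symm⟩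
    obtain ⟨s, hs⟩ := h.pow_dvd n
    have ha : a = (l : ℤ) + 1 - n := by omega
    refine ⟨π ^ m * s * p ^ l, ?_⟩
    have h1 := congrArg (algebraMap R K) hs
    simp only [map_mul, map_pow] at h1 ⊢
    rw [ha, zpow_sub₀ hp0, zpow_add_one₀ hp0, zpow_add_one₀ hπ0, zpow_natCast, zpow_natCast,
      zpow_natCast, mul_div_assoc', eq_div_iff (pow_ne_zero n hp0)]
    linear_combination
      (-(algebraMap R K π ^ m * algebraMap R K p ^ l * algebraMap R K p)) * h1
  · obtain ⟨m, rfl⟩ : ∃ m : ℕ, a = m + 1 := ⟨(a - 1).toNat, by omega⟩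
    refine ⟨p ^ m, ?_⟩
    norm_cast
    simp [pow_succ']

theorem IsRankTwoPair.exists_eq_zpow_iff (h : IsRankTwoPair p π) {b a : ℤ} :
    (∃ r : R, algebraMap R K r = algebraMap R K π ^ b * algebraMap R K p ^ a) ↔
      0 < b ∨ b = 0 ∧ 0 ≤ a := by
  have hp0 : algebraMap R K p ≠ 0 := by simpa using h.left_ne_zero
  have hπ0 : algebraMap R K π ≠ 0 := by simpa using h.right_ne_zero
  constructor
  · rintro ⟨r, hr⟩
    by_contra hn
    obtain ⟨s, hs⟩ := h.exists_eq_zpow_of_pos (K := K) (b := -b) (a := -a) (by omega)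
    have h1 : algebraMap R K (p * s * r) = 1 := by
      rw [map_mul, hs, hr, zpow_neg, zpow_neg]
      have := zpow_ne_zero b hπ0
      have := zpow_ne_zero a hp0
      field_simp
    rw [← map_one (algebraMap R K)] at h1
    exact h.not_isUnit (IsUnit.of_mul_eq_one (s * r)
      (by rw [← mul_assoc]; exact IsFractionRing.injective R K h1))
  · intro hab
    by_cases h0 : 0 < b ∨ b = 0 ∧ 0 < a
    · obtain ⟨r, hr⟩ := h.exists_eq_zpow_of_pos (K := K) h0
      exact ⟨_, hr⟩
    · obtain ⟨rfl, rfl⟩ : b = 0 ∧ a = 0 := by omega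
      exact ⟨1, by simp⟩

theorem IsRankTwoPair.isValuationDomainWithGroup (h : IsRankTwoPair p π) :
    IsValuationDomainWithGroup R (ℤ ×ₗ ℤ) := by
  set K := FractionRing R
  have hp0 : algebraMap R K p ≠ 0 := by simpa using h.left_ne_zero
  have hπ0 : algebraMap R K π ≠ 0 := by simpa using h.right_ne_zero
  let φ : Multiplicative (ℤ ×ₗ ℤ) →* K :=
    { toFun := fun g => algebraMap R K π ^ (ofLex g.toAdd).1 * algebraMap R K p ^ (ofLex g.toAdd).2
      map_one' := by simp
      map_mul' := fun g g' => by
        simp only [toAdd_mul, ofLex_add, Prod.fst_add, Prod.snd_add, zpow_add₀ hp0, zpow_add₀ hπ0]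
        ring }
  refine isValuationDomainWithGroup_of_parametrization φ (fun g => ?_) fun k hk => ?_
  · refine (h.exists_eq_zpow_iff (K := K)).trans ?_
    rw [Prod.Lex.le_iff]
    simp [eq_comm]
  · obtain ⟨b, a, u, hu⟩ := h.exists_eq_zpow k hk
    exact ⟨toLex (b, a), u, hu⟩

variable (K) in
/-- The localization of `R` away from `p`. -/
def awaySubalgebra (p : R) : Subalgebra R K where
  carrier := {k | ∃ (n : ℕ) (r : R), algebraMap R K p ^ n * k = algebraMap R K r}
  algebraMap_mem' r := ⟨0, r, by simp⟩
  add_mem' := by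
    rintro k l ⟨m, r, hr⟩ ⟨n, s, hs⟩
    refine ⟨m + n, p ^ n * r + p ^ m * s, ?_⟩
    simp only [map_add, map_mul, map_pow, ← hr, ← hs]
    ring
  mul_mem' := by
    rintro k l ⟨m, r, hr⟩ ⟨n, s, hs⟩
    refine ⟨m + n, r * s, ?_⟩
    simp only [map_mul, ← hr, ← hs]
    ring

/-- An overring is determined by the exponents `(b, a)` of the monomials in it, an upward closed set
stable under addition. Any `b < 0` yields everything; otherwise a negative exponent forces `p⁻¹`. -/
theorem IsRankTwoPair.setOf_subalgebra_ne_top_eq (h : IsRankTwoPair p π) :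
    {S : Subalgebra R K | S ≠ ⊤} = {⊥, awaySubalgebra K p} := by
  have hp0 : algebraMap R K p ≠ 0 := by simpa using h.left_ne_zero
  have hπ0 : algebraMap R K π ≠ 0 := by simpa using h.right_ne_zero
  ext S
  simp only [Set.mem_ofPred_eq, Set.mem_insert_iff, Set.mem_singleton_iff]
  constructor
  · intro hS
    have hmem : ∀ (b a : ℤ), 0 < b ∨ b = 0 ∧ 0 ≤ a →
        algebraMap R K π ^ b * algebraMap R K p ^ a ∈ S := by
      intro b a hab
      obtain ⟨r, hr⟩ := (h.exists_eq_zpow_iff (K := K)).2 hab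
      exact hr ▸ S.algebraMap_mem r
    have hunit : ∀ (u : Rˣ) (k : K), algebraMap R K u * k ∈ S → k ∈ S := by
      intro u k hk
      have := S.mul_mem (S.algebraMap_mem (u⁻¹ : Rˣ)) hk
      rwa [← mul_assoc, ← map_mul, Units.inv_mul, map_one, one_mul] at this
    have hmul : ∀ (b a b' a' : ℤ), algebraMap R K π ^ b * algebraMap R K p ^ a ∈ S →
        0 < b' - b ∨ b' - b = 0 ∧ 0 ≤ a' - a →
        algebraMap R K π ^ b' * algebraMap R K p ^ a' ∈ S := by
      intro b a b' a' h1 h2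
      have := S.mul_mem h1 (hmem _ _ h2)
      rwa [mul_mul_mul_comm, ← zpow_add₀ hπ0, ← zpow_add₀ hp0, add_sub_cancel,
        add_sub_cancel] at this
    have hpow : ∀ (b a : ℤ) (n : ℕ), algebraMap R K π ^ b * algebraMap R K p ^ a ∈ S →
        algebraMap R K π ^ (b * n) * algebraMap R K p ^ (a * n) ∈ S := by
      intro b a n h1
      have := S.pow_mem h1 n
      rwa [mul_pow, ← zpow_natCast, ← zpow_natCast, ← zpow_mul, ← zpow_mul] at this
    have hrep : ∀ k ∈ S, k ∈ awaySubalgebra K p := by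
      intro k hk
      obtain rfl | hk0 := eq_or_ne k 0
      · exact zero_mem _
      obtain ⟨b, a, u, rfl⟩ := h.exists_eq_zpow k hk0
      have hk' := hunit u _ hk
      by_cases hb : 0 ≤ b
      · obtain ⟨r, hr⟩ := (h.exists_eq_zpow_iff (K := K) (b := b) (a := (-a).toNat + a)).2
          (by omega)
        refine ⟨(-a).toNat, u * r, ?_⟩
        rw [map_mul, hr, zpow_add₀ hp0, zpow_natCast]
        ring
      · exfalso
        apply hS
        refine eq_top_iff.2 fun l _ => ?_
        obtain rfl | hl0 := eq_or_ne l 0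
        · exact zero_mem _
        obtain ⟨b', a', v, rfl⟩ := h.exists_eq_zpow l hl0
        -- Since `b ≤ -1`, the power `|b'| + 1` brings the `π`-exponent strictly below `b'`.
        refine S.mul_mem (S.algebraMap_mem _) (hmul _ _ _ _ (hpow b a (b'.natAbs + 1) hk') ?_)
        left
        push_cast
        have : b ≤ -1 := by omega
        nlinarith [neg_abs_le b', abs_nonneg b']
    by_cases hb : S = ⊥
    · exact Or.inl hb
    refine Or.inr (le_antisymm hrep ?_)
    obtain ⟨s, hsS, hs⟩ := SetLike.exists_of_lt (bot_lt_iff_ne_bot.2 hb)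
    have hs0 : s ≠ 0 := by
      rintro rfl
      exact hs (zero_mem _)
    obtain ⟨b, a, u, rfl⟩ := h.exists_eq_zpow s hs0
    have hpos : ¬ (0 < b ∨ b = 0 ∧ 0 ≤ a) := by
      intro hh
      obtain ⟨r, hr⟩ := (h.exists_eq_zpow_iff (K := K)).2 hh
      exact hs (Algebra.mem_bot.2 ⟨u * r, by rw [map_mul, hr]⟩)
    have hinv : (algebraMap R K p)⁻¹ ∈ S := by
      -- `(0, -1)` is the largest negative element of the lexicographic order.
      have := hmul b a 0 (-1) (hunit u _ hsS) (by omega)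
      simpa using this
    rintro k ⟨n, r, hr⟩
    have : k = (algebraMap R K p)⁻¹ ^ n * algebraMap R K r := by
      rw [← hr, inv_pow, inv_mul_cancel_left₀ (pow_ne_zero n hp0)]
    rw [this]
    exact S.mul_mem (S.pow_mem hinv n) (S.algebraMap_mem r)
  · rintro (rfl | rfl) htop
    · have : (algebraMap R K p)⁻¹ ∈ (⊥ : Subalgebra R K) := htop ▸ Algebra.mem_top
      obtain ⟨r, hr⟩ := Algebra.mem_bot.1 this
      have := (h.exists_eq_zpow_iff (K := K) (b := 0) (a := -1)).1 ⟨r, by simpa using hr⟩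
      omega
    · have : (algebraMap R K π)⁻¹ ∈ awaySubalgebra K p := htop ▸ Algebra.mem_top
      obtain ⟨n, r, hr⟩ := this
      have := (h.exists_eq_zpow_iff (K := K) (b := -1) (a := n)).1
        ⟨r, by rw [← hr, mul_comm]; simp⟩
      omega

theorem IsRankTwoPair.bot_ne_awaySubalgebra (h : IsRankTwoPair p π) :
    (⊥ : Subalgebra R K) ≠ awaySubalgebra K p := by
  intro htop
  have hp0 : algebraMap R K p ≠ 0 := by simpa using h.left_ne_zero
  have : (algebraMap R K p)⁻¹ ∈ (⊥ : Subalgebra R K) :=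
    htop ▸ ⟨1, 1, by rw [pow_one, mul_inv_cancel₀ hp0, map_one]⟩
  obtain ⟨r, hr⟩ := Algebra.mem_bot.1 this
  have := (h.exists_eq_zpow_iff (K := K) (b := 0) (a := -1)).1 ⟨r, by simpa using hr⟩
  omega

end RankTwo

/-! ### Pinching maximal ideal: the square of `𝔪`, and value group `ℝ` -/

section RealValued

set_option linter.unusedSectionVars false
set_option linter.overlappingInstances false

variable {R : Type*} [CommRing R] [IsDomain R] [IsLocalRing R]

local notation "𝔪" => IsLocalRing.maximalIdeal R

/-- It suffices that `𝔪²` is not principal. If `𝔪² = (c)`, either all products lie in `c𝔪`, so that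
`c ∈ c𝔪`, or some `ab` is a unit times `c`; in the latter case `b / c` inverts `𝔪` and `𝔪 = (a)`. -/
theorem IsPinching.exists_maximalIdeal_mul_self (h : IsPinching 𝔪) :
    ∃ x : R, x ≠ 0 ∧ ∀ r, r ∈ 𝔪 * 𝔪 ↔ ∃ q ∈ 𝔪, x * q = r := by
  refine h.exists_mem_iff (mul_ne_zero h.ne_bot h.ne_bot) ?_
  rintro ⟨c, hc⟩
  have hc0 : c ≠ 0 := by
    rintro rfl
    refine mul_ne_zero h.ne_bot h.ne_bot (hc.trans ?_)
    simp
  have hcm : ∀ a ∈ 𝔪, ∀ b ∈ 𝔪, ∃ t, a * b = c * t := by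
    intro a ha b hb
    have := Ideal.mul_mem_mul ha hb
    rw [hc] at this
    obtain ⟨t, ht⟩ := Submodule.mem_span_singleton.1 this
    exact ⟨t, by rw [← ht, smul_eq_mul, mul_comm]⟩
  by_cases hall : ∀ a ∈ 𝔪, ∀ b ∈ 𝔪, ∃ t ∈ 𝔪, a * b = c * t
  · have hle : 𝔪 * 𝔪 ≤ Ideal.span {c} * 𝔪 := Ideal.mul_le.2 fun a ha b hb => by
      obtain ⟨t, ht, hab⟩ := hall a ha b hb
      rw [hab]
      exact Ideal.mul_mem_mul (Ideal.mem_span_singleton_self c) ht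
    have hmem : c ∈ 𝔪 * 𝔪 := by
      rw [hc]
      exact Submodule.mem_span_singleton_self c
    obtain ⟨t, ht, hct⟩ := Ideal.mem_span_singleton_mul.1 (hle hmem)
    have : t = 1 := mul_left_cancel₀ hc0 (by rw [hct, mul_one])
    rw [this, IsLocalRing.mem_maximalIdeal] at ht
    exact ht isUnit_one
  · push Not at hall
    obtain ⟨a, ha, b, hb, hab⟩ := hall
    obtain ⟨u, hu⟩ := hcm a ha b hb
    have huu : IsUnit u := by
      by_contra hn
      exact hab u hn hu
    obtain ⟨u, rfl⟩ := huu
    have hb0 : b ≠ 0 := by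
      rintro rfl
      rw [mul_zero, eq_comm] at hu
      exact mul_ne_zero hc0 u.ne_zero hu
    refine h.not_isPrincipal ⟨a, le_antisymm (fun r hr => ?_) ?_⟩
    · obtain ⟨t, ht⟩ := hcm r hr b hb
      refine Submodule.mem_span_singleton.2 ⟨(u⁻¹ : Rˣ) * t, mul_right_cancel₀ hb0 ?_⟩
      rw [ht, smul_eq_mul, mul_assoc, hu]
      linear_combination c * t * u.inv_mul
    · rwa [Submodule.span_singleton_le_iff_mem]

/-- By Nakayama the idempotent ideal `𝔪` is not finitely generated. A nonprincipal `(a, b) = y𝔪`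
would make it so; hence `R` is Bézout and local. -/
theorem IsPinching.valuationRing_of_maximalIdeal_mul_self (h : IsPinching 𝔪) (hm : 𝔪 * 𝔪 = 𝔪) :
    ValuationRing R := by
  have hfg : ¬ (𝔪).FG := by
    intro hfg
    refine h.ne_bot (Submodule.eq_bot_of_le_smul_of_le_jacobson_bot 𝔪 𝔪 hfg ?_ ?_)
    · rw [smul_eq_mul, hm]
    · exact IsLocalRing.maximalIdeal_le_jacobson _
  classical
  have : IsBezout R := by
    rw [IsBezout.iff_span_pair_isPrincipal]
    intro a b
    by_contra hab
    have h0 : (Ideal.span {a, b} : Ideal R) ≠ ⊥ := by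
      intro h0
      rw [h0] at hab
      exact hab inferInstance
    obtain ⟨y, hy, hm⟩ := h.exists_mem_iff h0 hab
    obtain ⟨a', ha', rfl⟩ := (hm a).1 (Ideal.subset_span (by simp))
    obtain ⟨b', hb', rfl⟩ := (hm b).1 (Ideal.subset_span (by simp))
    refine hfg ⟨{a', b'}, le_antisymm ?_ fun r hr => ?_⟩
    · rw [Submodule.span_le]
      intro r hr
      simp only [Finset.coe_insert, Finset.coe_singleton, Set.mem_insert_iff,
        Set.mem_singleton_iff] at hr
      rcases hr with rfl | rfl <;> assumption
    · have := (hm (y * r)).2 ⟨r, hr, rfl⟩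
      obtain ⟨s, t, hst⟩ := Ideal.mem_span_pair.1 this
      have : r = s * a' + t * b' := mul_left_cancel₀ hy (by rw [← hst]; ring)
      rw [this, Finset.coe_insert, Finset.coe_singleton]
      exact Ideal.mem_span_pair.2 ⟨s, t, rfl⟩
  infer_instance

theorem IsPinching.exists_dvd_pow [ValuationRing R] (h : IsPinching 𝔪) (a : R)
    (ha : ¬ IsUnit a) (b : R) (hb : b ≠ 0) : ∃ n : ℕ, b ∣ a ^ n := by
  obtain rfl | ha0 := eq_or_ne a 0
  · exact ⟨1, by simp⟩
  have h0 := h.iInfPow_eq_bot ha0 ((IsLocalRing.mem_maximalIdeal a).2 ha)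
  by_contra! hn
  apply hb
  have : b ∈ iInfPow a := mem_iInfPow.2 fun n =>
    (ValuationRing.dvd_total (a ^ n) b).resolve_right (hn n)
  rw [h0] at this
  simpa using this

/-- A value `> 1` is that of `1 / a` with `a` a nonunit, and `b ∣ aⁿ` bounds the value of `c / b` by
that of `(1 / a)ⁿ`. -/
theorem ValuationRing.mulArchimedean_valueGroup {R : Type*} [CommRing R] [IsDomain R]
    [ValuationRing R]
    (harch : ∀ a : R, ¬ IsUnit a → ∀ b : R, b ≠ 0 → ∃ n : ℕ, b ∣ a ^ n) :
    MulArchimedean (ValuationRing.ValueGroup R (FractionRing R))ˣ := by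
  set K := FractionRing R
  set v := ValuationRing.valuation R K
  have hle : ∀ r : R, v (algebraMap R K r) ≤ 1 := fun r =>
    (ValuationRing.mem_integer_iff R K _).2 ⟨r, rfl⟩
  refine ⟨fun x y hy => ?_⟩
  obtain ⟨k, hk⟩ := ValuationRing.valuation_surjective R K (x : ValuationRing.ValueGroup R K)
  obtain ⟨l, hl⟩ := ValuationRing.valuation_surjective R K (y : ValuationRing.ValueGroup R K)
  have hl0 : l ≠ 0 := by
    rintro rfl
    rw [map_zero] at hl
    exact y.ne_zero hl.symm
  have hl1 : 1 < v l := by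
    rw [hl, ← Units.val_one, Units.val_lt_val]
    exact hy
  obtain ⟨a, ha⟩ : ∃ a, algebraMap R K a = l⁻¹ := by
    refine (ValuationRing.mem_integer_iff R K _).1 ?_
    change v l⁻¹ ≤ 1
    rw [map_inv₀]
    exact inv_le_one_of_one_le₀ hl1.le
  have hau : ¬ IsUnit a := by
    rintro ⟨u, rfl⟩
    have : l = algebraMap R K (u⁻¹ : Rˣ) := by rw [map_units_inv, ha, inv_inv]
    exact absurd (hle (u⁻¹ : Rˣ)) (by rw [← this]; exact not_le.2 hl1)
  obtain ⟨c, b, hb, rfl⟩ := IsFractionRing.div_surjective (A := R) k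
  have hb0 : algebraMap R K b ≠ 0 := by simpa using nonZeroDivisors.ne_zero hb
  obtain ⟨n, d, hd⟩ := harch a hau b (nonZeroDivisors.ne_zero hb)
  refine ⟨n, ?_⟩
  rw [← Units.val_le_val, Units.val_pow_eq_pow_val, ← hk, ← hl, ← map_pow]
  have : algebraMap R K c / algebraMap R K b = algebraMap R K (c * d) * l ^ n := by
    have h1 := congrArg (algebraMap R K) hd
    rw [map_pow, map_mul, ha, inv_pow, inv_eq_iff_eq_inv, eq_comm] at h1
    rw [← h1, map_mul]
    have hd0 : algebraMap R K d ≠ 0 := by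
      intro h0
      rw [h0, mul_zero, inv_zero] at h1
      exact pow_ne_zero n hl0 h1.symm
    rw [mul_inv, mul_mul_mul_comm, mul_inv_cancel₀ hd0, mul_one, div_eq_mul_inv]
  rw [this, map_mul]
  exact mul_le_of_le_one_left' (hle _)

/-- Hölder's theorem embeds the archimedean value group in `ℝ`. The image is dense because `𝔪` is
not principal, and it is everything because each cut `{w ≥ r}` is an ideal, hence `(c)` or `y𝔪`, and
so has its endpoint `r` in the image. -/
theorem IsPinching.isValuationDomainWithGroup_real [ValuationRing R] (h : IsPinching 𝔪) :
    IsValuationDomainWithGroup R ℝ := by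
  have := ValuationRing.mulArchimedean_valueGroup h.exists_dvd_pow
  refine ⟨inferInstance, ?_⟩
  set K := FractionRing R
  set v := ValuationRing.valuation R K with hv
  let Γ := (ValuationRing.ValueGroup R K)ˣ
  obtain ⟨F, hF⟩ := Archimedean.exists_orderAddMonoidHom_real_injective (Additive Γ)
  have hFmono : StrictMono F := F.monotone'.strictMono_of_injective hF
  have hv0 : ∀ {k : K}, k ≠ 0 → v k ≠ 0 := fun hk => (map_ne_zero v).2 hk
  classical
  -- The sign turns the multiplicative value into an additive one, nonnegative exactly on `R`; the
  -- value at `0` is a dummy.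
  let w : K → ℝ := fun k => if hk : k = 0 then 0 else -F (.ofMul (Units.mk0 (v k) (hv0 hk)))
  have hw : ∀ (k : K) (hk : k ≠ 0), w k = -F (.ofMul (Units.mk0 (v k) (hv0 hk))) :=
    fun k hk => dif_neg hk
  have hwmul : ∀ k l : K, k ≠ 0 → l ≠ 0 → w (k * l) = w k + w l := by
    intro k l hk hl
    rw [hw _ (mul_ne_zero hk hl), hw _ hk, hw _ hl, ← neg_add, ← map_add, ← ofMul_mul]
    congr 3
    exact Units.ext (map_mul v k l)
  have hwone : w 1 = 0 := by
    have := hwmul 1 1 one_ne_zero one_ne_zero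
    rw [mul_one] at this
    linarith
  have hwinv : ∀ k : K, k ≠ 0 → w k⁻¹ = -w k := by
    intro k hk
    have := hwmul k k⁻¹ hk (inv_ne_zero hk)
    rw [mul_inv_cancel₀ hk, hwone] at this
    linarith
  have hwnonneg : ∀ k : K, k ≠ 0 → (0 ≤ w k ↔ ∃ r, algebraMap R K r = k) := by
    intro k hk
    rw [hw k hk, neg_nonneg, ← map_zero F, hFmono.le_iff_le, ← ofMul_one,
      Additive.ofMul_le, ← Units.val_le_val]
    exact ValuationRing.mem_integer_iff R K k
  have hal : ∀ {r : R}, r ≠ 0 → algebraMap R K r ≠ 0 := fun hr => by simpa using hr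
  have hwdvd : ∀ a b : R, a ≠ 0 → b ≠ 0 →
      (w (algebraMap R K a) ≤ w (algebraMap R K b) ↔ a ∣ b) := by
    intro a b ha hb
    have h1 := hwnonneg (algebraMap R K b * (algebraMap R K a)⁻¹)
      (mul_ne_zero (hal hb) (inv_ne_zero (hal ha)))
    rw [hwmul _ _ (hal hb) (inv_ne_zero (hal ha)), hwinv _ (hal ha), ← sub_eq_add_neg,
      sub_nonneg] at h1
    rw [h1]
    refine exists_congr fun c => ?_
    rw [eq_mul_inv_iff_mul_eq₀ (hal ha), ← map_mul, (IsFractionRing.injective R K).eq_iff,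
      eq_comm, mul_comm]
  have hwunit : ∀ a : R, a ≠ 0 → (a ∈ 𝔪 ↔ 0 < w (algebraMap R K a)) := by
    intro a ha
    have h1 := hwdvd a 1 ha one_ne_zero
    rw [map_one, hwone, ← isUnit_iff_dvd_one] at h1
    rw [IsLocalRing.mem_maximalIdeal, mem_nonunits_iff, ← h1, not_le]
  let H : AddSubgroup ℝ := (F : Additive Γ →+ ℝ).range
  have hH : ∀ r : ℝ, r ∈ H ↔ ∃ k : K, k ≠ 0 ∧ w k = r := by
    intro r
    constructor
    · rintro ⟨γ, rfl⟩
      obtain ⟨k, hk⟩ := ValuationRing.valuation_surjective R K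
        ((γ.toMul⁻¹ : Γ) : ValuationRing.ValueGroup R K)
      have hk0 : k ≠ 0 := by
        rintro rfl
        rw [map_zero] at hk
        exact (γ.toMul⁻¹ : Γ).ne_zero hk.symm
      refine ⟨k, hk0, ?_⟩
      have : Units.mk0 (v k) (hv0 hk0) = γ.toMul⁻¹ := Units.ext hk
      rw [hw k hk0, this, ofMul_inv, map_neg, neg_neg]
      rfl
    · rintro ⟨k, hk, rfl⟩
      rw [hw k hk]
      exact H.neg_mem ⟨_, rfl⟩
  obtain ⟨m₀, hm₀, hm₀0⟩ := Submodule.exists_mem_ne_zero_of_ne_bot h.ne_bot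
  -- If the image were cyclic, an element of least positive value would generate `𝔪`.
  have hdense : Dense (H : Set ℝ) := by
    refine (AddSubgroup.dense_or_cyclic H).resolve_right ?_
    rintro ⟨a, ha⟩
    have hmemH : ∀ r : ℝ, r ∈ H ↔ ∃ n : ℤ, n * |a| = r := by
      intro r
      rw [ha, AddSubgroup.mem_closure_singleton]
      simp only [zsmul_eq_mul]
      rcases abs_choice a with h1 | h1
      · rw [h1]
      · rw [h1]
        constructor
        · rintro ⟨n, hn⟩
          exact ⟨-n, by push_cast; linarith⟩
        · rintro ⟨n, hn⟩
          exact ⟨-n, by push_cast; linarith⟩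
    have hpos : ∀ r ∈ 𝔪, r ≠ 0 → 0 < |a| ∧ |a| ≤ w (algebraMap R K r) := by
      intro r hr hr0
      have h1 := (hwunit r hr0).1 hr
      obtain ⟨n, hn⟩ := (hmemH _).1 ((hH _).2 ⟨_, hal hr0, rfl⟩)
      rw [← hn] at h1 ⊢
      have hn0 : (0 : ℝ) < n := pos_of_mul_pos_left h1 (abs_nonneg a)
      have hn1 : (1 : ℝ) ≤ n := by exact_mod_cast (Int.cast_pos.1 hn0)
      exact ⟨pos_of_mul_pos_right h1 hn0.le, by nlinarith [abs_nonneg a]⟩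
    obtain ⟨k, hk0, hk⟩ := (hH |a|).1 ((hmemH _).2 ⟨1, by simp⟩)
    obtain ⟨c, rfl⟩ := (hwnonneg k hk0).1 (by rw [hk]; exact abs_nonneg a)
    have hc0 : c ≠ 0 := by
      rintro rfl
      exact hk0 (map_zero _)
    refine h.not_isPrincipal ⟨c, le_antisymm (fun r hr => ?_) ?_⟩
    · obtain rfl | hr0 := eq_or_ne r 0
      · exact zero_mem _
      · refine Ideal.mem_span_singleton.2 ((hwdvd c r hc0 hr0).1 ?_)
        rw [hk]
        exact (hpos r hr hr0).2
    · rw [Submodule.span_singleton_le_iff_mem, hwunit c hc0, hk]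
      exact (hpos m₀ hm₀ hm₀0).1
  have hbetween : ∀ r s : ℝ, 0 ≤ r → r < s → ∃ c : R, c ≠ 0 ∧
      r < w (algebraMap R K c) ∧ w (algebraMap R K c) < s := by
    intro r s hr hrs
    obtain ⟨t, htH, hrt, hts⟩ := hdense.exists_between hrs
    obtain ⟨k, hk0, rfl⟩ := (hH t).1 htH
    obtain ⟨c, rfl⟩ := (hwnonneg k hk0).1 (hr.trans hrt.le)
    refine ⟨c, ?_, hrt, hts⟩
    rintro rfl
    exact hk0 (map_zero _)
  have hpos : ∀ r : ℝ, 0 < r → r ∈ H := by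
    intro r hr
    let I : Ideal R :=
      { carrier := {a | a ≠ 0 → r ≤ w (algebraMap R K a)}
        zero_mem' := fun h0 => absurd rfl h0
        add_mem' := by
          intro a b ha hb hab
          obtain rfl | ha0 := eq_or_ne a 0
          · rw [zero_add] at hab ⊢
            exact hb hab
          obtain rfl | hb0 := eq_or_ne b 0
          · rw [add_zero] at hab ⊢
            exact ha hab
          rcases ValuationRing.dvd_total a b with hd | hd
          · exact (ha ha0).trans ((hwdvd a _ ha0 hab).2 (dvd_add dvd_rfl hd))
          · exact (hb hb0).trans ((hwdvd b _ hb0 hab).2 (dvd_add hd dvd_rfl))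
        smul_mem' := by
          intro c a ha hca
          have ha0 : a ≠ 0 := right_ne_zero_of_mul hca
          exact (ha ha0).trans ((hwdvd a _ ha0 hca).2 (dvd_mul_left a c)) }
    have hI : ∀ a, a ≠ 0 → (a ∈ I ↔ r ≤ w (algebraMap R K a)) :=
      fun a ha => ⟨fun h => h ha, fun h _ => h⟩
    have hI0 : I ≠ ⊥ := by
      obtain ⟨c, hc0, hc, -⟩ := hbetween r (r + 1) hr.le (by linarith)
      intro h0
      have := (hI c hc0).2 hc.le
      rw [h0] at this
      exact hc0 ((Submodule.mem_bot R).1 this)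
    by_cases hp : I.IsPrincipal
    · obtain ⟨c, hc⟩ := hp
      have hc0 : c ≠ 0 := by
        rintro rfl
        exact hI0 (hc.trans (Submodule.span_zero_singleton R))
      refine (hH r).2 ⟨algebraMap R K c, hal hc0, le_antisymm ?_ ?_⟩
      · by_contra! hlt
        obtain ⟨d, hd0, hd1, hd2⟩ := hbetween _ _ hr.le hlt
        have := (hI d hd0).2 hd1.le
        rw [hc] at this
        obtain ⟨t, ht⟩ := Submodule.mem_span_singleton.1 this
        have hcd : c ∣ d := ⟨t, by rw [← ht, smul_eq_mul, mul_comm]⟩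
        exact absurd ((hwdvd c d hc0 hd0).2 hcd) (not_le.2 hd2)
      · exact (hI c hc0).1 (hc ▸ Submodule.mem_span_singleton_self c)
    -- Now `I = y𝔪` is also the set `{w > w y}`; by density the two cuts have the same endpoint, so
    -- `w y = r`.
    · obtain ⟨y, hy, hm⟩ := h.exists_mem_iff hI0 hp
      have hyI : ∀ d, d ≠ 0 → (d ∈ I ↔ w (algebraMap R K y) < w (algebraMap R K d)) := by
        intro d hd0
        rw [hm]
        constructor
        · rintro ⟨q, hq, rfl⟩
          have hq0 : q ≠ 0 := right_ne_zero_of_mul hd0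
          rw [map_mul, hwmul _ _ (hal hy) (hal hq0)]
          linarith [(hwunit q hq0).1 hq]
        · intro hlt
          obtain ⟨q, rfl⟩ := (hwdvd y d hy hd0).1 hlt.le
          have hq0 : q ≠ 0 := right_ne_zero_of_mul hd0
          refine ⟨q, (hwunit q hq0).2 ?_, rfl⟩
          rw [map_mul, hwmul _ _ (hal hy) (hal hq0)] at hlt
          linarith
      have hy0 : 0 ≤ w (algebraMap R K y) := (hwnonneg _ (hal hy)).2 ⟨y, rfl⟩
      refine (hH r).2 ⟨algebraMap R K y, hal hy, le_antisymm ?_ ?_⟩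
      · by_contra! hlt
        obtain ⟨d, hd0, hd1, hd2⟩ := hbetween _ _ hr.le hlt
        exact absurd ((hyI d hd0).1 ((hI d hd0).2 hd1.le)) (not_lt.2 hd2.le)
      · by_contra! hlt
        obtain ⟨d, hd0, hd1, hd2⟩ := hbetween _ _ hy0 hlt
        exact absurd ((hI d hd0).1 ((hyI d hd0).2 hd1)) (not_le.2 hd2)
  have hsurj : Function.Surjective F := by
    intro r
    have : r ∈ H := by
      rcases lt_trichotomy r 0 with h1 | rfl | h1
      · rw [← neg_neg r]
        exact H.neg_mem (hpos _ (neg_pos.2 h1))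
      · exact H.zero_mem
      · exact hpos r h1
    exact this
  exact ⟨OrderMonoidIso.mk
    (MulEquiv.ofBijective (AddMonoidHom.toMultiplicativeRight (F : Additive Γ →+ ℝ)) ⟨hF, hsurj⟩)
    (fun {a b} => hFmono.le_iff_le)⟩

end RealValued

/-! ### Pinching maximal ideal with `x ∈ 𝔪`: two-generated PVDs -/

section PVD

set_option linter.unusedSectionVars false

variable {R : Type*} [CommRing R] [IsDomain R] [IsLocalRing R]
variable {K : Type*} [Field K] [Algebra R K] [IsFractionRing R K]

local notation "𝔪" => IsLocalRing.maximalIdeal R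

variable (R K) in
/-- The overring `(𝔪 : 𝔪)` of a local domain with maximal ideal `𝔪`. -/
def maximalIdealMultipliers : Subalgebra R K where
  carrier := {w | ∀ m ∈ 𝔪, ∃ m' ∈ 𝔪, algebraMap R K m * w = algebraMap R K m'}
  algebraMap_mem' r m hm := ⟨m * r, Ideal.mul_mem_right _ _ hm, by simp⟩
  add_mem' := by
    intro a b ha hb m hm
    obtain ⟨s, hs, hs'⟩ := ha m hm
    obtain ⟨t, ht, ht'⟩ := hb m hm
    exact ⟨s + t, Ideal.add_mem _ hs ht, by rw [mul_add, hs', ht', map_add]⟩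
  mul_mem' := by
    intro a b ha hb m hm
    obtain ⟨s, hs, hs'⟩ := ha m hm
    obtain ⟨t, ht, ht'⟩ := hb s hs
    exact ⟨t, ht, by rw [← mul_assoc, hs', ht']⟩

local notation "𝔚" => maximalIdealMultipliers R K

/-- A nonprincipal pinching maximal ideal `𝔪` with `𝔪 ^ 2 = x 𝔪` and `x ∈ 𝔪`. -/
structure IsPinchingPVD (x : R) : Prop where
  isPinching : IsPinching 𝔪
  ne_zero : x ≠ 0
  mem : x ∈ 𝔪
  mem_mul_self_iff : ∀ r, r ∈ 𝔪 * 𝔪 ↔ ∃ q ∈ 𝔪, x * q = r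

variable {x : R}

theorem IsPinchingPVD.algebraMap_ne_zero (h : IsPinchingPVD x) : algebraMap R K x ≠ 0 := by
  simpa using h.ne_zero

/-- This is `𝔪 = x(𝔪 : 𝔪)`: for `a ∈ 𝔪`, `a𝔪 ⊆ 𝔪² = x𝔪`, so `a / x` maps `𝔪` to itself. -/
theorem IsPinchingPVD.mem_iff (h : IsPinchingPVD x) {w : K} :
    w ∈ 𝔚 ↔ ∃ m ∈ 𝔪, algebraMap R K x * w = algebraMap R K m := by
  refine ⟨fun hw => hw x h.mem, ?_⟩
  rintro ⟨a, ha, haw⟩ m hm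
  obtain ⟨q, hq, hmq⟩ := (h.mem_mul_self_iff _).1 (Ideal.mul_mem_mul hm ha)
  refine ⟨q, hq, mul_left_cancel₀ (h.algebraMap_ne_zero (K := K)) ?_⟩
  rw [← map_mul, hmq, map_mul, ← haw, mul_left_comm]

theorem IsPinchingPVD.exists_of_mem (h : IsPinchingPVD x) {m : R} (hm : m ∈ 𝔪) :
    ∃ w ∈ 𝔚, algebraMap R K m = algebraMap R K x * w := by
  refine ⟨algebraMap R K m / algebraMap R K x, h.mem_iff.2 ⟨m, hm, ?_⟩, ?_⟩ <;>
  rw [mul_div_cancel₀ _ (h.algebraMap_ne_zero (K := K))]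

/-- An element of `𝔪` is not invertible in `(𝔪 : 𝔪)`. -/
theorem mul_ne_one_of_mem_maximalIdeal {m : R} (hm : m ∈ 𝔪) {w : K} (hw : w ∈ 𝔚) :
    algebraMap R K m * w ≠ 1 := by
  intro h1
  obtain ⟨m', hm', h2⟩ := hw m hm
  rw [h1, ← map_one (algebraMap R K)] at h2
  rw [← IsFractionRing.injective R K h2, IsLocalRing.mem_maximalIdeal] at hm'
  exact hm' isUnit_one

theorem isUnit_of_algebraMap_mul_eq_one {r : R} {w : K} (hw : w ∈ 𝔚)
    (h1 : algebraMap R K r * w = 1) : IsUnit r := by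
  by_contra hr
  exact mul_ne_one_of_mem_maximalIdeal ((IsLocalRing.mem_maximalIdeal r).2 hr) hw h1

theorem eq_inv_of_unit_mul_eq_one {u : Rˣ} {w : K} (h1 : algebraMap R K u * w = 1) :
    w = algebraMap R K (u⁻¹ : Rˣ) := by
  rw [map_units_inv]
  exact eq_inv_of_mul_eq_one_right h1

/-- If `(𝔪 : 𝔪)` were `R`, then `𝔪 = xR` would be principal. -/
theorem IsPinchingPVD.exists_notMem_bot (h : IsPinchingPVD x) :
    ∃ w ∈ 𝔚, w ∉ (⊥ : Subalgebra R K) := by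
  by_contra! hw
  refine h.isPinching.not_isPrincipal ⟨x, le_antisymm (fun m hm => ?_) ?_⟩
  · obtain ⟨w, hw', hmw⟩ := h.exists_of_mem (K := K) hm
    obtain ⟨r, rfl⟩ := Algebra.mem_bot.1 (hw w hw')
    rw [← map_mul] at hmw
    exact Submodule.mem_span_singleton.2
      ⟨r, by rw [IsFractionRing.injective R K hmw, smul_eq_mul, mul_comm]⟩
  · rw [Submodule.span_singleton_le_iff_mem]
    exact h.mem

/-- Each nonzero element of `(𝔪 : 𝔪)` is associated, in that ring, to an element of `R`. -/
theorem IsPinchingPVD.exists_eq_mul_unit (h : IsPinchingPVD x) {z : K} (hz : z ∈ 𝔚)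
    (hz0 : z ≠ 0) : ∃ (y : R) (u : K), u ∈ 𝔚 ∧ u⁻¹ ∈ 𝔚 ∧ u ≠ 0 ∧ z = algebraMap R K y * u := by
  have hx0 := h.algebraMap_ne_zero (K := K)
  -- With `W = (𝔪 : 𝔪)`, this is `zxW`, contained in `xW = 𝔪`. It will turn out to be `y𝔪 = yxW`, so
  -- that `zW = yW`.
  let I : Ideal R :=
    { carrier := {r | ∃ w ∈ 𝔚, algebraMap R K r = z * algebraMap R K x * w}
      zero_mem' := ⟨0, zero_mem _, by simp⟩
      add_mem' := by
        rintro a b ⟨v, hv, hv'⟩ ⟨w, hw, hw'⟩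
        exact ⟨v + w, add_mem hv hw, by rw [map_add, hv', hw', mul_add]⟩
      smul_mem' := by
        rintro c a ⟨v, hv, hv'⟩
        refine ⟨algebraMap R K c * v, mul_mem (Subalgebra.algebraMap_mem _ c) hv, ?_⟩
        rw [smul_eq_mul, map_mul, hv', mul_left_comm] }
  have hI : ∀ r, r ∈ I ↔ ∃ w ∈ 𝔚, algebraMap R K r = z * algebraMap R K x * w :=
    fun r => Iff.rfl
  have hex : ∀ w ∈ 𝔚, ∃ r ∈ I, algebraMap R K r = z * algebraMap R K x * w := by
    intro w hw
    obtain ⟨m, -, hm⟩ := mul_mem hz hw x h.mem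
    have : algebraMap R K m = z * algebraMap R K x * w := by rw [← hm]; ring
    exact ⟨m, ⟨w, hw, this⟩, this⟩
  obtain ⟨r₁, hr₁I, hr₁⟩ := hex 1 (one_mem _)
  rw [mul_one] at hr₁
  have hI0 : I ≠ ⊥ := by
    intro h0
    rw [h0, Submodule.mem_bot] at hr₁I
    rw [hr₁I, map_zero] at hr₁
    exact mul_ne_zero hz0 hx0 hr₁.symm
  have hInp : ¬ I.IsPrincipal := by
    rintro ⟨c, hc⟩
    obtain ⟨w₀, hw₀, hcw⟩ := (hI c).1 (hc ▸ Submodule.mem_span_singleton_self c)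
    -- A principal `zxW` would give `W = w₀R`; then `w₀² ∈ w₀R` puts `w₀` in `R`, and `W = R`.
    have key : ∀ w ∈ 𝔚, ∃ t : R, w = w₀ * algebraMap R K t := by
      intro w hw
      obtain ⟨r, hrI, hr⟩ := hex w hw
      rw [hc] at hrI
      obtain ⟨t, rfl⟩ := Submodule.mem_span_singleton.1 hrI
      rw [smul_eq_mul, map_mul, hcw] at hr
      refine ⟨t, mul_left_cancel₀ (mul_ne_zero hz0 hx0) ?_⟩
      rw [← hr]
      ring
    obtain ⟨t₀, ht₀⟩ := key 1 (one_mem _)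
    obtain ⟨t₁, ht₁⟩ := key _ (mul_mem hw₀ hw₀)
    have hw₀0 : w₀ ≠ 0 := by
      rintro rfl
      simp at ht₀
    obtain rfl := mul_left_cancel₀ hw₀0 ht₁
    obtain ⟨w, hw, hwb⟩ := h.exists_notMem_bot (K := K)
    obtain ⟨t, rfl⟩ := key w hw
    exact hwb (Algebra.mem_bot.2 ⟨t₁ * t, by simp⟩)
  obtain ⟨y, hy, hm⟩ := h.isPinching.exists_mem_iff hI0 hInp
  obtain ⟨m, hmm, hym⟩ := (hm _).1 hr₁I
  obtain ⟨u, hu, hmu⟩ := h.exists_of_mem (K := K) hmm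
  obtain ⟨v, hv, hxv⟩ := (hI _).1 ((hm _).2 ⟨x, h.mem, rfl⟩)
  have hzu : z = algebraMap R K y * u := by
    refine mul_right_cancel₀ hx0 ?_
    rw [← hr₁, ← hym, map_mul, hmu]
    ring
  have hyv : algebraMap R K y = z * v := by
    refine mul_right_cancel₀ hx0 ?_
    rw [← map_mul, hxv]
    ring
  have huv : u * v = 1 := by
    refine mul_left_cancel₀ hz0 ?_
    rw [mul_one, mul_left_comm, ← hyv, mul_comm, ← hzu]
  refine ⟨y, u, hu, ?_, left_ne_zero_of_mul_eq_one huv, hzu⟩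
  rwa [inv_eq_of_mul_eq_one_right huv]

/-- A generator of `(x, xw)` would be `x` times a unit of `R`, forcing `w ∈ R`. So `(x, xw) = y𝔪`,
and `x ∈ y𝔪 = yxW` makes `y` a unit. Dividing by `x` gives `W = R + Rw` for every `w ∈ W` outside
`R`. -/
theorem IsPinchingPVD.exists_span_pair_eq (h : IsPinchingPVD x) {w : K} (hw : w ∈ 𝔚)
    (hwb : w ∉ (⊥ : Subalgebra R K)) :
    ∃ m : R, algebraMap R K m = algebraMap R K x * w ∧ 𝔪 = Ideal.span {x, m} := by
  have hx0 := h.algebraMap_ne_zero (K := K)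
  obtain ⟨m, hm, hxw⟩ := h.mem_iff.1 hw
  refine ⟨m, hxw.symm, ?_⟩
  have hxI : x ∈ Ideal.span {x, m} := Ideal.subset_span (by simp)
  have hmI : m ∈ Ideal.span {x, m} := Ideal.subset_span (by simp)
  have hle : Ideal.span {x, m} ≤ 𝔪 := by
    rw [Ideal.span_le]
    rintro r (rfl | rfl)
    · exact h.mem
    · exact hm
  have hI0 : Ideal.span {x, m} ≠ ⊥ := by
    intro h0
    rw [h0] at hxI
    exact h.ne_zero (by simpa using hxI)
  have hInp : ¬ (Ideal.span {x, m}).IsPrincipal := by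
    rintro ⟨c, hc⟩
    have hcI : c ∈ Ideal.span {x, m} := by
      rw [hc]
      exact Submodule.mem_span_singleton_self c
    obtain ⟨c', hc', hcc'⟩ := h.exists_of_mem (K := K) (hle hcI)
    rw [hc] at hxI hmI
    obtain ⟨r, hr⟩ := Submodule.mem_span_singleton.1 hxI
    obtain ⟨s, hs⟩ := Submodule.mem_span_singleton.1 hmI
    have h1 : algebraMap R K r * c' = 1 := by
      refine mul_left_cancel₀ hx0 ?_
      rw [mul_one, mul_left_comm, ← hcc', ← map_mul, ← smul_eq_mul, hr]
    have h2 : algebraMap R K s * c' = w := by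
      refine mul_left_cancel₀ hx0 ?_
      rw [mul_left_comm, ← hcc', ← map_mul, ← smul_eq_mul, hs, hxw]
    obtain ⟨u, rfl⟩ := isUnit_of_algebraMap_mul_eq_one hc' h1
    rw [eq_inv_of_unit_mul_eq_one h1] at h2
    exact hwb (Algebra.mem_bot.2 ⟨_, by rw [← h2, map_mul]⟩)
  obtain ⟨y, hy, hmem⟩ := h.isPinching.exists_mem_iff hI0 hInp
  obtain ⟨q, hq, hyq⟩ := (hmem x).1 hxI
  obtain ⟨v, hv, hqv⟩ := h.exists_of_mem (K := K) hq
  have h1 : algebraMap R K y * v = 1 := by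
    refine mul_left_cancel₀ hx0 ?_
    rw [mul_one, mul_left_comm, ← hqv, ← map_mul, hyq]
  obtain ⟨u, rfl⟩ := isUnit_of_algebraMap_mul_eq_one hv h1
  refine le_antisymm (fun r hr => ?_) hle
  rw [hmem]
  exact ⟨(u⁻¹ : Rˣ) * r, Ideal.mul_mem_left _ _ hr, by simp⟩

theorem IsPinchingPVD.isTwoGenerated (h : IsPinchingPVD x) : IsTwoGenerated R := by
  obtain ⟨w, hw, hwb⟩ := h.exists_notMem_bot (K := FractionRing R)
  obtain ⟨m, -, hm⟩ := h.exists_span_pair_eq hw hwb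
  intro I
  by_cases hp : I.IsPrincipal
  · obtain ⟨a, rfl⟩ := hp
    exact ⟨a, a, by simp⟩
  · have h0 : I ≠ ⊥ := by
      rintro rfl
      exact hp inferInstance
    obtain ⟨y, -, rfl⟩ := h.isPinching.exists_eq I h0 hp
    refine ⟨y * x, y * m, ?_⟩
    rw [hm, Ideal.span_mul_span', Set.singleton_mul, Set.image_pair]

/-- Each nonzero element of the quotient field is a power of `x` times a unit of `(𝔪 : 𝔪)`. -/
theorem IsPinchingPVD.exists_eq_zpow_mul (h : IsPinchingPVD x) {k : K} (hk : k ≠ 0) :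
    ∃ (n : ℤ) (u : K), u ∈ 𝔚 ∧ u⁻¹ ∈ 𝔚 ∧ u ≠ 0 ∧ k = algebraMap R K x ^ n * u := by
  have hx0 := h.algebraMap_ne_zero (K := K)
  have hbot : ∀ r : R, r ≠ 0 → ∃ n : ℕ, ∀ w ∈ 𝔚, algebraMap R K r ≠ algebraMap R K x ^ n * w := by
    let P : Ideal R :=
      { carrier := {r | ∀ n : ℕ, ∃ w ∈ 𝔚, algebraMap R K r = algebraMap R K x ^ n * w}
        zero_mem' := fun n => ⟨0, zero_mem _, by simp⟩
        add_mem' := by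
          intro a b ha hb n
          obtain ⟨v, hv, hv'⟩ := ha n
          obtain ⟨w, hw, hw'⟩ := hb n
          exact ⟨v + w, add_mem hv hw, by rw [map_add, hv', hw', mul_add]⟩
        smul_mem' := by
          intro c a ha n
          obtain ⟨v, hv, hv'⟩ := ha n
          refine ⟨algebraMap R K c * v, mul_mem (Subalgebra.algebraMap_mem _ c) hv, ?_⟩
          rw [smul_eq_mul, map_mul, hv', mul_left_comm] }
    have hP : P = ⊥ := by
      refine h.isPinching.eq_bot_of_mul_mem h.isPinching.ne_top h.mem ?_ ?_
      -- `P = R ∩ ⋂ xⁿW` is stable under multiplication by `W`; if `P = (c)`, then `cw ∈ (c)` for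
      -- all `w ∈ W`, against `W ≠ R`.
      · rintro h0 ⟨c, hc⟩
        have hcP : c ∈ P := by
          rw [hc]
          exact Submodule.mem_span_singleton_self c
        have hc0 : algebraMap R K c ≠ 0 := by
          have : c ≠ 0 := by
            rintro rfl
            exact h0 (hc.trans (Submodule.span_zero_singleton R))
          simpa using this
        obtain ⟨w, hw, hwb⟩ := h.exists_notMem_bot (K := K)
        obtain ⟨v, hv, hcv⟩ := hcP 1
        rw [pow_one] at hcv
        obtain ⟨r, -, hr⟩ := mul_mem hv hw x h.mem
        rw [← mul_assoc, ← hcv] at hr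
        have hrP : r ∈ P := by
          intro n
          obtain ⟨v', hv', hcv'⟩ := hcP n
          exact ⟨v' * w, mul_mem hv' hw, by rw [← hr, hcv', mul_assoc]⟩
        rw [hc] at hrP
        obtain ⟨t, rfl⟩ := Submodule.mem_span_singleton.1 hrP
        refine hwb (Algebra.mem_bot.2 ⟨t, mul_left_cancel₀ hc0 ?_⟩)
        rw [hr, smul_eq_mul, map_mul, mul_comm]
      · intro r hr n
        obtain ⟨w, hw, hrw⟩ := hr (n + 1)
        refine ⟨w, hw, mul_left_cancel₀ hx0 ?_⟩
        rw [← map_mul, hrw, pow_succ', mul_assoc]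
    intro r hr
    by_contra! hn
    have : r ∈ P := hn
    rw [hP, Submodule.mem_bot] at this
    exact hr this
  have key : ∀ r : R, r ≠ 0 → ∃ (n : ℕ) (u : K), u ∈ 𝔚 ∧ u⁻¹ ∈ 𝔚 ∧ u ≠ 0 ∧
      algebraMap R K r = algebraMap R K x ^ n * u := by
    intro r hr
    classical
    have hn := hbot r hr
    have hr0 : algebraMap R K r ≠ 0 := by simpa using hr
    have hn0 : Nat.find hn ≠ 0 := fun h0 =>
      Nat.find_spec hn _ (Subalgebra.algebraMap_mem _ r) (by rw [h0]; simp)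
    obtain ⟨n, hn'⟩ := Nat.exists_eq_succ_of_ne_zero hn0
    have h1 := Nat.find_min hn (m := n) (by omega)
    have h2 := Nat.find_spec hn
    rw [hn'] at h2
    push Not at h1
    obtain ⟨w, hw, hrw⟩ := h1
    have hw0 : w ≠ 0 := by
      rintro rfl
      exact hr0 (by rw [hrw, mul_zero])
    -- By maximality of `n` the factor `y` is a unit: otherwise `y ∈ 𝔪 = xW` would contribute one
    -- more `x`.
    obtain ⟨y, u, hu, hui, hu0, rfl⟩ := h.exists_eq_mul_unit hw hw0
    have hy : IsUnit y := by
      by_contra hy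
      obtain ⟨v, hv, hyv⟩ := h.exists_of_mem (K := K) ((IsLocalRing.mem_maximalIdeal y).2 hy)
      exact h2 _ (mul_mem hv hu) (by rw [hrw, hyv, Nat.succ_eq_add_one, pow_succ]; ring)
    obtain ⟨y, rfl⟩ := hy
    refine ⟨n, _, hw, ?_, hw0, hrw⟩
    rw [mul_inv, ← map_units_inv]
    exact mul_mem (Subalgebra.algebraMap_mem _ _) hui
  obtain ⟨a, b, hb, rfl⟩ := IsFractionRing.div_surjective (A := R) k
  have ha0 : a ≠ 0 := by
    rintro rfl
    simp at hk
  obtain ⟨m, u, hu, hui, hu0, ha⟩ := key a ha0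
  obtain ⟨n, v, hv, hvi, hv0, hb⟩ := key b (nonZeroDivisors.ne_zero hb)
  refine ⟨(m : ℤ) - n, u * v⁻¹, mul_mem hu hvi, ?_, mul_ne_zero hu0 (inv_ne_zero hv0), ?_⟩
  · rw [mul_inv, inv_inv]
    exact mul_mem hui hv
  · rw [ha, hb, zpow_sub₀ hx0, zpow_natCast, zpow_natCast, mul_div_mul_comm,
      div_eq_mul_inv u]

theorem IsPinchingPVD.zpow_mem {n : ℤ} (hn : 0 ≤ n) : algebraMap R K x ^ n ∈ 𝔚 := by
  lift n to ℕ using hn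
  rw [zpow_natCast, ← map_pow]
  exact Subalgebra.algebraMap_mem _ _

theorem IsPinchingPVD.zpow_mul_mem_maximalIdeal_iff (h : IsPinchingPVD x) {n : ℤ} {u : K}
    (hu : u ∈ 𝔚) (hui : u⁻¹ ∈ 𝔚) (hu0 : u ≠ 0) :
    (∃ m ∈ 𝔪, algebraMap R K m = algebraMap R K x ^ n * u) ↔ 0 < n := by
  have hx0 := h.algebraMap_ne_zero (K := K)
  constructor
  · rintro ⟨m, hm, hmu⟩
    by_contra! hn
    refine mul_ne_one_of_mem_maximalIdeal (K := K) hm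
      (mul_mem hui (zpow_mem (x := x) (n := -n) (by omega))) ?_
    rw [hmu, zpow_neg]
    have := zpow_ne_zero n hx0
    field_simp
  · intro hn
    obtain ⟨m, hm, hxm⟩ := mul_mem (zpow_mem (x := x) (n := n - 1) (by omega)) hu x h.mem
    refine ⟨m, hm, ?_⟩
    rw [← hxm, ← mul_assoc, ← zpow_one_add₀ hx0, add_sub_cancel]

theorem IsPinchingPVD.zpow_mul_mem_iff (h : IsPinchingPVD x) {n : ℤ} {u : K}
    (hu : u ∈ 𝔚) (hui : u⁻¹ ∈ 𝔚) (hu0 : u ≠ 0) :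
    algebraMap R K x ^ n * u ∈ 𝔚 ↔ 0 ≤ n := by
  have hx0 := h.algebraMap_ne_zero (K := K)
  rw [h.mem_iff, ← Int.lt_add_one_iff, ← h.zpow_mul_mem_maximalIdeal_iff hu hui hu0]
  refine exists_congr fun m => and_congr_right fun _ => ?_
  rw [zpow_add_one₀ hx0, eq_comm, mul_comm _ (algebraMap R K x), mul_assoc]

theorem IsPinchingPVD.mem_or_inv_mem (h : IsPinchingPVD x) (k : K) : k ∈ 𝔚 ∨ k⁻¹ ∈ 𝔚 := by
  obtain rfl | hk := eq_or_ne k 0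
  · exact Or.inl (zero_mem _)
  obtain ⟨n, u, hu, hui, hu0, rfl⟩ := h.exists_eq_zpow_mul hk
  rcases le_total 0 n with hn | hn
  · exact Or.inl (mul_mem (zpow_mem hn) hu)
  · rw [mul_inv, ← zpow_neg]
    exact Or.inr (mul_mem (zpow_mem (by omega)) hui)

/-- Every overring contains `𝔪 = xW`, hence all elements of positive `x`-order. One element of
negative order then produces all of `K`; otherwise the overring lies in `W`, and a single element
outside `R` generates `W`. -/
theorem IsPinchingPVD.setOf_subalgebra_ne_top_eq (h : IsPinchingPVD x) :
    {S : Subalgebra R K | S ≠ ⊤} = {⊥, 𝔚} := by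
  have hx0 := h.algebraMap_ne_zero (K := K)
  have hm : ∀ {n : ℤ} {u : K} (S : Subalgebra R K), u ∈ 𝔚 → u⁻¹ ∈ 𝔚 → u ≠ 0 → 0 < n →
      algebraMap R K x ^ n * u ∈ S := by
    intro n u S hu hui hu0 hn
    obtain ⟨m, -, hm⟩ := (h.zpow_mul_mem_maximalIdeal_iff hu hui hu0).2 hn
    exact hm ▸ S.algebraMap_mem m
  have htop : 𝔚 ≠ ⊤ := by
    intro ht
    have : algebraMap R K x ^ (-1 : ℤ) * 1 ∈ 𝔚 := by
      rw [ht]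
      exact Algebra.mem_top
    rw [h.zpow_mul_mem_iff (one_mem _) (by simp) one_ne_zero] at this
    omega
  ext S
  simp only [Set.mem_ofPred_eq, Set.mem_insert_iff, Set.mem_singleton_iff]
  constructor
  · intro hS
    have hle : S ≤ 𝔚 := by
      by_contra hn
      obtain ⟨s, hsS, hs⟩ := SetLike.not_le_iff_exists.1 hn
      have hs0 : s ≠ 0 := by
        rintro rfl
        exact hs (zero_mem _)
      obtain ⟨n, u, hu, hui, hu0, rfl⟩ := h.exists_eq_zpow_mul hs0
      rw [h.zpow_mul_mem_iff hu hui hu0, not_le] at hs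
      refine hS (eq_top_iff.2 fun k _ => ?_)
      obtain rfl | hk0 := eq_or_ne k 0
      · exact zero_mem _
      obtain ⟨l, v, hv, hvi, hv0, rfl⟩ := h.exists_eq_zpow_mul hk0
      have h1 := S.pow_mem hsS (l.natAbs + 1)
      have huN : ∀ N : ℕ, u ^ N ∈ 𝔚 ∧ (u ^ N)⁻¹ ∈ 𝔚 := fun N =>
        ⟨pow_mem hu N, by rw [← inv_pow]; exact pow_mem hui N⟩
      have hv' := mul_mem hv (huN (l.natAbs + 1)).2
      have hvi' : (v * (u ^ (l.natAbs + 1))⁻¹)⁻¹ ∈ 𝔚 := by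
        rw [mul_inv, inv_inv]
        exact mul_mem hvi (huN _).1
      -- As `n ≤ -1`, the power `|l| + 1` brings the order of `s` strictly below `l`.
      have hpos : 0 < l - n * ((l.natAbs + 1 : ℕ) : ℤ) := by
        push_cast
        nlinarith [neg_abs_le l, abs_nonneg l]
      have h2 := S.mul_mem h1 (hm S hv' hvi'
        (mul_ne_zero hv0 (inv_ne_zero (pow_ne_zero _ hu0))) hpos)
      convert h2 using 1
      rw [mul_pow, ← zpow_natCast (algebraMap R K x ^ n), ← zpow_mul, mul_mul_mul_comm,
        ← zpow_add₀ hx0, add_sub_cancel]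
      have := pow_ne_zero (l.natAbs + 1) hu0
      field_simp
    by_cases hb : S = ⊥
    · exact Or.inl hb
    refine Or.inr (le_antisymm hle fun k hk => ?_)
    obtain ⟨s, hsS, hs⟩ := SetLike.exists_of_lt (bot_lt_iff_ne_bot.2 hb)
    obtain ⟨m, hms, hspan⟩ := h.exists_span_pair_eq (hle hsS) hs
    obtain ⟨l, hl, hkl⟩ := h.mem_iff.1 hk
    rw [hspan] at hl
    obtain ⟨a, b, rfl⟩ := Ideal.mem_span_pair.1 hl
    have : k = algebraMap R K a + algebraMap R K b * s := by
      refine mul_left_cancel₀ hx0 ?_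
      rw [hkl, map_add, map_mul, map_mul, hms]
      ring
    rw [this]
    exact S.add_mem (S.algebraMap_mem a) (S.mul_mem (S.algebraMap_mem b) hsS)
  · rintro (rfl | rfl)
    · intro hb
      exact htop (top_le_iff.1 (hb ▸ bot_le))
    · exact htop

theorem IsPinchingPVD.bot_ne (h : IsPinchingPVD x) : (⊥ : Subalgebra R K) ≠ 𝔚 := by
  obtain ⟨w, hw, hwb⟩ := h.exists_notMem_bot (K := K)
  intro he
  rw [he] at hwb
  exact hwb hw

theorem IsPinchingPVD.eq_maximalIdeal (h : IsPinchingPVD x) {P : Ideal R} (hP : P.IsPrime)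
    (h0 : P ≠ ⊥) : P = 𝔪 := by
  refine le_antisymm (IsLocalRing.le_maximalIdeal hP.ne_top) fun m hm => ?_
  obtain ⟨r, hrP, hr0⟩ := Submodule.exists_mem_ne_zero_of_ne_bot h0
  have hrK : algebraMap R (FractionRing R) r ≠ 0 := by simpa using hr0
  obtain ⟨n, u, hu, hui, hu0, hr⟩ := h.exists_eq_zpow_mul hrK
  have hn : 0 ≤ n := by
    rw [← h.zpow_mul_mem_iff hu hui hu0, ← hr]
    exact Subalgebra.algebraMap_mem _ _
  lift n to ℕ using hn
  -- `m' = u⁻¹x` lies in `R`, so `r m' = x^(n+1)` is in `P`; then `x ∈ P`, and `𝔪² = x𝔪` gives `𝔪 ⊆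
  -- P`.
  obtain ⟨m', -, hm'⟩ := hui x h.mem
  have hxP : x ∈ P := by
    refine hP.mem_of_pow_mem (n + 1) ?_
    have : x ^ (n + 1) = r * m' := by
      apply IsFractionRing.injective R (FractionRing R)
      rw [map_mul, hr, ← hm', map_pow, pow_succ, zpow_natCast]
      field_simp
    rw [this]
    exact Ideal.mul_mem_right _ _ hrP
  refine hP.mem_of_pow_mem 2 ?_
  obtain ⟨q, -, hq⟩ := (h.mem_mul_self_iff _).1 (Ideal.mul_mem_mul hm hm)
  rw [pow_two, ← hq]
  exact Ideal.mul_mem_right _ _ hxP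

/-- The only nonzero prime is `𝔪`, the set of elements of positive `x`-order. Orders add, so a
product of positive order has a factor of positive order. -/
theorem IsPinchingPVD.isPVD (h : IsPinchingPVD x) : IsPVD R := by
  intro P hP a b hab
  obtain rfl | ha := eq_or_ne a 0
  · exact Or.inl ⟨0, P.zero_mem, map_zero _⟩
  obtain rfl | hb := eq_or_ne b 0
  · exact Or.inr ⟨0, P.zero_mem, map_zero _⟩
  obtain ⟨r, hr, hrab⟩ := hab
  have hP0 : P ≠ ⊥ := by
    rintro rfl
    rw [SetLike.mem_coe, Submodule.mem_bot] at hr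
    rw [hr, map_zero] at hrab
    exact mul_ne_zero ha hb hrab.symm
  rw [h.eq_maximalIdeal hP hP0] at hr ⊢
  have hx0 := h.algebraMap_ne_zero (K := FractionRing R)
  obtain ⟨m, u, hu, hui, hu0, rfl⟩ := h.exists_eq_zpow_mul ha
  obtain ⟨n, v, hv, hvi, hv0, rfl⟩ := h.exists_eq_zpow_mul hb
  rw [mul_mul_mul_comm, ← zpow_add₀ hx0] at hrab
  have hmn := (h.zpow_mul_mem_maximalIdeal_iff (mul_mem hu hv)
    (by rw [mul_inv]; exact mul_mem hui hvi) (mul_ne_zero hu0 hv0)).1 ⟨r, hr, hrab⟩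
  rcases (by omega : 0 < m ∨ 0 < n) with hm | hn
  · exact Or.inl ((h.zpow_mul_mem_maximalIdeal_iff hu hui hu0).2 hm)
  · exact Or.inr ((h.zpow_mul_mem_maximalIdeal_iff hv hvi hv0).2 hn)

theorem IsPinchingPVD.not_valuationRing (h : IsPinchingPVD x) : ¬ ValuationRing R := by
  intro hval
  obtain ⟨w, hw, hwb⟩ := h.exists_notMem_bot (K := FractionRing R)
  obtain ⟨m, -, hm⟩ := h.exists_span_pair_eq hw hwb
  apply h.isPinching.not_isPrincipal
  rw [hm]
  infer_instance

theorem IsPinchingPVD.not_isField (h : IsPinchingPVD x) : ¬ IsField R := by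
  intro hf
  exact h.isPinching.ne_bot (IsLocalRing.isField_iff_maximalIdeal_eq.1 hf)

theorem IsPinchingPVD.isTwoGeneratedPVDNotDVR (h : IsPinchingPVD x) :
    IsTwoGeneratedPVDNotDVR R :=
  ⟨h.isPVD, h.isTwoGenerated, h.not_isField, fun ⟨hv, _⟩ => h.not_valuationRing hv⟩

end PVD

/-! ### Mutual exclusion of the types, and the local count -/

section Exclusive

set_option linter.unusedSectionVars false
set_option linter.overlappingInstances false

variable {R : Type*} [CommRing R] [IsDomain R]

theorem IsValuationDomainWithGroup.valuationRing {G : Type*} [AddCommGroup G] [LinearOrder G]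
    (h : IsValuationDomainWithGroup R G) : ValuationRing R := h.1

theorem IsValuationDomainWithGroup.not_isField {G : Type*} [AddCommGroup G] [LinearOrder G]
    [Nontrivial G] (h : IsValuationDomainWithGroup R G) : ¬ IsField R := by
  obtain ⟨hv, ⟨e⟩⟩ := h
  intro hf
  let v := ValuationRing.valuation R (FractionRing R)
  have hle : ∀ k, v k ≤ 1 := by
    intro k
    refine (ValuationRing.mem_integer_iff R (FractionRing R) k).2 ?_
    let := hf.toField
    exact (IsFractionRing.surjective_iff_isField (R := R) (K := FractionRing R)).2 hf k
  have hone : ∀ x : (ValuationRing.ValueGroup R (FractionRing R))ˣ, x = 1 := by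
    intro x
    obtain ⟨k, hk⟩ := ValuationRing.valuation_surjective R (FractionRing R)
      (x : ValuationRing.ValueGroup R (FractionRing R))
    have hk0 : 0 < v k := by
      rw [zero_lt_iff]
      intro h0
      exact x.ne_zero (hk.symm.trans h0)
    have h1 := hle k⁻¹
    rw [map_inv₀, inv_le_one₀ hk0] at h1
    exact Units.ext (hk.symm.trans (le_antisymm (hle k) h1))
  obtain ⟨g, hg⟩ := exists_ne (0 : G)
  apply hg
  have := congrArg e (hone (e.symm (.ofAdd g)))
  rw [map_one, OrderMonoidIso.apply_symm_apply] at this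
  exact this

theorem IsValuationDomainWithGroup.nonempty_orderMonoidIso {G H : Type*} [AddCommGroup G]
    [LinearOrder G] [AddCommGroup H] [LinearOrder H] (hG : IsValuationDomainWithGroup R G)
    (hH : IsValuationDomainWithGroup R H) :
    Nonempty (Multiplicative G ≃*o Multiplicative H) := by
  obtain ⟨_, ⟨e⟩⟩ := hG
  obtain ⟨_, ⟨f⟩⟩ := hH
  exact ⟨e.symm.trans f⟩

/-- Density of the order separates `ℝ` from `ℤ` and from `ℤ × ℤ`. -/
theorem IsValuationDomainWithGroup.denselyOrdered {G H : Type*} [AddCommGroup G]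
    [LinearOrder G] [AddCommGroup H] [LinearOrder H] [DenselyOrdered G]
    (hG : IsValuationDomainWithGroup R G)
    (hH : IsValuationDomainWithGroup R H) : DenselyOrdered H := by
  obtain ⟨e⟩ := hH.nonempty_orderMonoidIso hG
  refine ⟨fun a b hab => ?_⟩
  have h1 : e (.ofAdd a) < e (.ofAdd b) := e.strictMono hab
  obtain ⟨c, hc, hc'⟩ := exists_between h1
  refine ⟨(e.symm c).toAdd, ?_, ?_⟩
  · have := e.symm.strictMono hc
    rwa [OrderMonoidIso.symm_apply_apply] at this
  · have := e.symm.strictMono hc'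
    rwa [OrderMonoidIso.symm_apply_apply] at this

theorem not_denselyOrdered_int_lex_int : ¬ DenselyOrdered (ℤ ×ₗ ℤ) := by
  intro h
  obtain ⟨c, h1, h2⟩ := exists_between (show toLex ((0 : ℤ), (0 : ℤ)) < toLex (0, 1) by
    simp [Prod.Lex.lt_iff])
  rw [Prod.Lex.lt_iff] at h1 h2
  simp at h1 h2
  omega

/-- `ℤ` is archimedean, while no multiple of `(0, 1)` reaches `(1, 0)`. -/
theorem IsValuationDomainWithGroup.not_int_lex_int_of_int
    (h : IsValuationDomainWithGroup R ℤ) : ¬ IsValuationDomainWithGroup R (ℤ ×ₗ ℤ) := by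
  intro h'
  obtain ⟨e⟩ := h.nonempty_orderMonoidIso h'
  have h0 : (1 : Multiplicative ℤ) < e.symm (.ofAdd (toLex (0, 1))) := by
    rw [← map_one e.symm]
    refine e.symm.strictMono ?_
    change toLex ((0 : ℤ), (0 : ℤ)) < toLex (0, 1)
    simp [Prod.Lex.lt_iff]
  obtain ⟨n, hn⟩ := MulArchimedean.arch (e.symm (.ofAdd (toLex (1, 0)))) h0
  rw [← map_pow, map_le_map_iff e.symm, ← ofAdd_nsmul] at hn
  have hn' : toLex ((1 : ℤ), (0 : ℤ)) ≤ n • toLex (0, 1) := hn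
  rw [Prod.Lex.le_iff] at hn'
  simp at hn'

theorem isDiscreteValuationRing_of_valuationRing [ValuationRing R] [IsNoetherianRing R]
    (hf : ¬ IsField R) : IsDiscreteValuationRing R := by
  have : IsPrincipalIdealRing R := 
    ⟨fun I => IsBezout.isPrincipal_of_FG I (IsNoetherian.noetherian I)⟩
  exact { not_a_field' := fun h => hf (IsLocalRing.isField_iff_maximalIdeal_eq.2 h) }

theorem IsTwoGenerated.isNoetherianRing (h : IsTwoGenerated R) : IsNoetherianRing R := by
  classical
  rw [isNoetherianRing_iff_ideal_fg]
  intro I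
  obtain ⟨a, b, rfl⟩ := h I
  exact ⟨{a, b}, by simp⟩

theorem IsTwoGeneratedPVDNotDVR.isNoetherianRing (h : IsTwoGeneratedPVDNotDVR R) :
    IsNoetherianRing R := h.2.1.isNoetherianRing

/-- A Noetherian valuation domain that is not a field is a DVR, which the definition excludes. -/
theorem IsTwoGeneratedPVDNotDVR.not_valuationRing (h : IsTwoGeneratedPVDNotDVR R) :
    ¬ ValuationRing R := by
  intro hv
  have := h.isNoetherianRing
  have := isDiscreteValuationRing_of_valuationRing h.2.2.1
  exact h.2.2.2 IsDiscreteValuationRing.isValuationDomainWithGroup_int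

theorem IsValuationDomainWithGroup.not_isNoetherianRing_of_real
    (h : IsValuationDomainWithGroup R ℝ) : ¬ IsNoetherianRing R := by
  intro _
  have := h.valuationRing
  have := isDiscreteValuationRing_of_valuationRing h.not_isField
  exact Int.not_denselyOrdered
    (h.denselyOrdered IsDiscreteValuationRing.isValuationDomainWithGroup_int)

theorem IsValuationDomainWithGroup.not_isNoetherianRing_of_int_lex_int
    (h : IsValuationDomainWithGroup R (ℤ ×ₗ ℤ)) : ¬ IsNoetherianRing R := by
  intro _
  have := h.valuationRing
  have := isDiscreteValuationRing_of_valuationRing h.not_isField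
  exact IsDiscreteValuationRing.isValuationDomainWithGroup_int.not_int_lex_int_of_int h

open Classical in
/-- The number of proper overrings of a local MPD domain, as predicted by its type. -/
noncomputable def overringCount (R : Type*) [CommRing R] [IsDomain R] : ℕ :=
  2 * ((if IsTwoGeneratedPVDNotDVR R then 1 else 0) +
    (if IsValuationDomainWithGroup R (ℤ ×ₗ ℤ) then 1 else 0)) +
  ((if IsValuationDomainWithGroup R ℝ then 1 else 0) +
    (if IsValuationDomainWithGroup R ℤ then 1 else 0))

/-- The overrings and the type of a local MPD domain `R` with quotient field `K`. -/
structure LocalMPDData (R K : Type*) [CommRing R] [IsDomain R] [Field K] [Algebra R K] : Prop where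
  isLocalRing : ∀ S : Subalgebra R K, IsLocalRing S
  finite : {S : Subalgebra R K | S ≠ ⊤}.Finite
  ncard : {S : Subalgebra R K | S ≠ ⊤}.ncard = overringCount R
  isNoetherianRing_iff : IsNoetherianRing R ↔
    ¬ IsValuationDomainWithGroup R ℝ ∧ ¬ IsValuationDomainWithGroup R (ℤ ×ₗ ℤ)
  valuationRing_iff : ValuationRing R ↔ ¬ IsTwoGeneratedPVDNotDVR R

variable {K : Type*} [Field K] [Algebra R K] [IsFractionRing R K]

/-- A field has no overring but itself and is of none of the four types, so both counts are zero. -/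
theorem IsField.localMPDData (hf : IsField R) : LocalMPDData R K := by
  have hsurj : Function.Surjective (algebraMap R K) :=
    IsFractionRing.surjective_iff_isField.2 hf
  have htop : ∀ S : Subalgebra R K, S = ⊤ := fun S => eq_top_iff.2 fun k _ => by
    obtain ⟨r, rfl⟩ := hsurj k
    exact S.algebraMap_mem r
  have hempty : {S : Subalgebra R K | S ≠ ⊤} = ∅ := by
    ext S
    simp [htop S]
  have hval : ValuationRing R := by
    let := hf.toField
    rw [ValuationRing.iff_isInteger_or_isInteger R K]
    exact fun k => Or.inl (hsurj k)
  have hnoeth : IsNoetherianRing R := by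
    rw [isNoetherianRing_iff_ideal_fg]
    intro I
    obtain rfl | hI := eq_or_ne I ⊥
    · exact Submodule.fg_bot
    · obtain ⟨a, haI, ha0⟩ := Submodule.exists_mem_ne_zero_of_ne_bot hI
      obtain ⟨b, hab⟩ := hf.mul_inv_cancel ha0
      rw [Ideal.eq_top_of_isUnit_mem I haI (IsUnit.of_mul_eq_one b hab)]
      exact ⟨{1}, by simp⟩
  have h1 : ¬ IsTwoGeneratedPVDNotDVR R := fun h => h.not_valuationRing hval
  have h2 : ¬ IsValuationDomainWithGroup R ℝ := fun h => h.not_isField hf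
  have h3 : ¬ IsValuationDomainWithGroup R (ℤ ×ₗ ℤ) := fun h => h.not_isField hf
  have h4 : ¬ IsValuationDomainWithGroup R ℤ := fun h => h.not_isField hf
  exact ⟨fun S => S.isLocalRing_of_valuationRing, by simp [hempty],
    by simp [overringCount, *], by simp [*], by simp [*]⟩

theorem IsDiscreteValuationRing.localMPDData [IsDiscreteValuationRing R] : LocalMPDData R K := by
  have hset := ValuationRing.setOf_subalgebra_ne_top_eq (K := K)
    (IsDiscreteValuationRing.not_isField R) IsDiscreteValuationRing.exists_dvd_pow
  have hval : ValuationRing R := inferInstance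
  have hnoeth : IsNoetherianRing R := inferInstance
  have h4 : IsValuationDomainWithGroup R ℤ :=
    IsDiscreteValuationRing.isValuationDomainWithGroup_int
  have h1 : ¬ IsTwoGeneratedPVDNotDVR R := fun h => h.not_valuationRing hval
  have h2 : ¬ IsValuationDomainWithGroup R ℝ := fun h => h.not_isNoetherianRing_of_real hnoeth
  have h3 : ¬ IsValuationDomainWithGroup R (ℤ ×ₗ ℤ) := h4.not_int_lex_int_of_int
  exact ⟨fun S => S.isLocalRing_of_valuationRing, by simp [hset],
    by simp [overringCount, *], by simp [*], by simp [*]⟩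

theorem IsRankTwoPair.localMPDData {p π : R} (h : IsRankTwoPair p π) : LocalMPDData R K := by
  have hset := h.setOf_subalgebra_ne_top_eq (K := K)
  have h3 := h.isValuationDomainWithGroup
  have hval : ValuationRing R := h3.valuationRing
  have hnoeth : ¬ IsNoetherianRing R := h3.not_isNoetherianRing_of_int_lex_int
  have h1 : ¬ IsTwoGeneratedPVDNotDVR R := fun h => h.not_valuationRing hval
  have h2 : ¬ IsValuationDomainWithGroup R ℝ := fun h =>
    not_denselyOrdered_int_lex_int (h.denselyOrdered h3)
  have h4 : ¬ IsValuationDomainWithGroup R ℤ := fun h => h.not_int_lex_int_of_int h3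
  exact ⟨fun S => S.isLocalRing_of_valuationRing, by simp [hset],
    by rw [hset, Set.ncard_pair h.bot_ne_awaySubalgebra]; simp [overringCount, *],
    by simp [*], by simp [*]⟩

theorem IsPinching.localMPDData_of_valuationRing [IsLocalRing R] [ValuationRing R]
    (h : IsPinching (IsLocalRing.maximalIdeal R)) : LocalMPDData R K := by
  have h2 := h.isValuationDomainWithGroup_real
  have hset := ValuationRing.setOf_subalgebra_ne_top_eq (K := K) h2.not_isField h.exists_dvd_pow
  have hval : ValuationRing R := inferInstance
  have hnoeth : ¬ IsNoetherianRing R := h2.not_isNoetherianRing_of_real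
  have h1 : ¬ IsTwoGeneratedPVDNotDVR R := fun h => h.not_valuationRing hval
  have h3 : ¬ IsValuationDomainWithGroup R (ℤ ×ₗ ℤ) := fun h =>
    not_denselyOrdered_int_lex_int (h2.denselyOrdered h)
  have h4 : ¬ IsValuationDomainWithGroup R ℤ := fun h =>
    Int.not_denselyOrdered (h2.denselyOrdered h)
  exact ⟨fun S => S.isLocalRing_of_valuationRing, by simp [hset],
    by simp [overringCount, *], by simp [*], by simp [*]⟩

theorem IsPinchingPVD.localMPDData [IsLocalRing R] {x : R} (h : IsPinchingPVD x) :
    LocalMPDData R K := by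
  have hset := h.setOf_subalgebra_ne_top_eq (K := K)
  have h1 := h.isTwoGeneratedPVDNotDVR
  have hval : ¬ ValuationRing R := h1.not_valuationRing
  have hnoeth : IsNoetherianRing R := h1.isNoetherianRing
  have h2 : ¬ IsValuationDomainWithGroup R ℝ := fun h => hval h.valuationRing
  have h3 : ¬ IsValuationDomainWithGroup R (ℤ ×ₗ ℤ) := fun h => hval h.valuationRing
  have h4 : ¬ IsValuationDomainWithGroup R ℤ := fun h => hval h.valuationRing
  refine ⟨fun S => ?_, by simp [hset],
    by rw [hset, Set.ncard_pair h.bot_ne]; simp [overringCount, *], by simp [*], by simp [*]⟩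
  by_cases hS : S = ⊤
  · subst hS
    exact Subalgebra.isLocalRing_of_mem_or_inv_mem _ fun _ => Or.inl Algebra.mem_top
  · have : S ∈ {S : Subalgebra R K | S ≠ ⊤} := hS
    rw [hset] at this
    rcases this with rfl | rfl
    · exact Subalgebra.isLocalRing_bot
    · exact Subalgebra.isLocalRing_of_mem_or_inv_mem _ h.mem_or_inv_mem

-- The case division: `Q` principal (field or DVR), `Q ≠ 𝔪` (rank two), and `Q = 𝔪` with `𝔪² = x𝔪`,
-- where `x` is a unit (real values) or lies in `𝔪` (PVD).
variable (K) in
theorem IsMPD.localMPDData [IsLocalRing R] (h : IsMPD R) : LocalMPDData R K := by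
  rcases h.isPrincipalIdealRing_or_exists_isPinching with hp | ⟨Q, hQ⟩
  · by_cases hf : IsField R
    · exact hf.localMPDData
    · have : IsDiscreteValuationRing R :=
        { not_a_field' := fun h => hf (IsLocalRing.isField_iff_maximalIdeal_eq.2 h) }
      exact IsDiscreteValuationRing.localMPDData
  · by_cases hM : IsLocalRing.maximalIdeal R = Q
    · subst hM
      obtain ⟨x, hx0, hx⟩ := hQ.exists_maximalIdeal_mul_self
      by_cases hxm : x ∈ IsLocalRing.maximalIdeal R
      · exact IsPinchingPVD.localMPDData ⟨hQ, hx0, hxm, hx⟩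
      · rw [IsLocalRing.mem_maximalIdeal, mem_nonunits_iff, not_not] at hxm
        obtain ⟨u, rfl⟩ := hxm
        have := hQ.valuationRing_of_maximalIdeal_mul_self
          (le_antisymm Ideal.mul_le_left fun r hr =>
            (hx r).2 ⟨(u⁻¹ : Rˣ) * r, Ideal.mul_mem_left _ _ hr, by simp⟩)
        exact hQ.localMPDData_of_valuationRing
    · obtain ⟨p, π, hp, hp0, hπ0, hdvd, hrep⟩ := hQ.exists_rank_two hM
      refine IsRankTwoPair.localMPDData (p := p) (π := π) ⟨hp0, hπ0, ?_, hdvd, hrep⟩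
      rw [← mem_nonunits_iff, ← IsLocalRing.mem_maximalIdeal, hp]
      exact Ideal.mem_span_singleton_self p

theorem IsMPD.isNoetherianRing_iff [IsLocalRing R] (h : IsMPD R) : IsNoetherianRing R ↔
    ¬ IsValuationDomainWithGroup R ℝ ∧ ¬ IsValuationDomainWithGroup R (ℤ ×ₗ ℤ) :=
  (h.localMPDData (FractionRing R)).isNoetherianRing_iff

theorem IsMPD.valuationRing_iff [IsLocalRing R] (h : IsMPD R) :
    ValuationRing R ↔ ¬ IsTwoGeneratedPVDNotDVR R :=
  (h.localMPDData (FractionRing R)).valuationRing_iff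

end Exclusive

/-! ### Local tests for Prüfer, Noetherian and Dedekind domains -/

section Prufer

set_option linter.unusedSectionVars false

variable {D : Type*} [CommRing D] [IsDomain D]

/-- Invertibility of `(a, b)` gives `aα + bβ = 1` with `α`, `β` in the inverse. Both summands lie in
`D`, so one is outside `M`; if it is `aα`, then `a` divides `b` in `D_M`, because `bα ∈ D`. -/
theorem IsPruferDomain.valuationRing (h : IsPruferDomain D) (M : Ideal D) [M.IsPrime] :
    ValuationRing (Localization.AtPrime M) := by
  set R := Localization.AtPrime M
  set F := FractionRing D
  have key : ∀ a b : D, algebraMap D R a ∣ algebraMap D R b ∨ algebraMap D R b ∣ algebraMap D R a := by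
    have aux : ∀ (a b d e : D), d ∉ M → a * e = b * d → algebraMap D R a ∣ algebraMap D R b := by
      intro a b d e hd hde
      have hu : IsUnit (algebraMap D R d) :=
        IsLocalization.map_units R (⟨d, hd⟩ : M.primeCompl)
      refine hu.dvd_mul_right.1 ⟨algebraMap D R e, ?_⟩
      rw [← map_mul, ← map_mul, hde]
    intro a b
    by_cases h0 : Ideal.span {a, b} = ⊥
    · have : b = 0 := by
        have : b ∈ Ideal.span {a, b} := Ideal.subset_span (by simp)
        rwa [h0] at this
      exact Or.inl (by simp [this])
    have hinv := h _ h0 (Submodule.fg_span (Set.toFinite _))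
    rw [IsInvertibleIdeal] at hinv
    obtain ⟨J, hJ⟩ := isUnit_iff_exists_inv.1 hinv
    have hmem : ∀ c ∈ Ideal.span {a, b}, ∀ α ∈ J, ∃ d : D, algebraMap D F d = algebraMap D F c * α := by
      intro c hc α hα
      have := FractionalIdeal.mul_mem_mul (FractionalIdeal.mem_coeIdeal_of_mem D⁰ hc) hα
      rw [hJ] at this
      exact (FractionalIdeal.mem_one_iff _).1 this
    have haI : a ∈ Ideal.span {a, b} := Ideal.subset_span (by simp)
    have hbI : b ∈ Ideal.span {a, b} := Ideal.subset_span (by simp)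
    have h1 : (1 : F) ∈ (Ideal.span {a, b} : FractionalIdeal D⁰ F) * J := by
      rw [hJ]
      exact FractionalIdeal.one_mem_one _
    rw [Ideal.span_insert, FractionalIdeal.coeIdeal_sup, add_mul,
      FractionalIdeal.coeIdeal_span_singleton, FractionalIdeal.coeIdeal_span_singleton,
      FractionalIdeal.mem_add] at h1
    obtain ⟨i, hi, j, hj, hij⟩ := h1
    obtain ⟨α, hα, rfl⟩ := FractionalIdeal.mem_singleton_mul.1 hi
    obtain ⟨β, hβ, rfl⟩ := FractionalIdeal.mem_singleton_mul.1 hj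
    obtain ⟨d₁, hd₁⟩ := hmem a haI α hα
    obtain ⟨d₂, hd₂⟩ := hmem b hbI β hβ
    have hd : d₁ + d₂ = 1 := by
      apply IsFractionRing.injective D F
      rw [map_add, hd₁, hd₂, hij, map_one]
    by_cases hd₁M : d₁ ∈ M
    · have hd₂M : d₂ ∉ M := fun hd₂M =>
        (inferInstance : M.IsPrime).ne_top ((Ideal.eq_top_iff_one M).2 (hd ▸ M.add_mem hd₁M hd₂M))
      obtain ⟨e, he⟩ := hmem a haI β hβ
      refine Or.inr (aux b a d₂ e hd₂M (IsFractionRing.injective D F ?_))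
      rw [map_mul, map_mul, he, hd₂]
      ring
    · obtain ⟨e, he⟩ := hmem b hbI α hα
      refine Or.inl (aux a b d₁ e hd₁M (IsFractionRing.injective D F ?_))
      rw [map_mul, map_mul, he, hd₁]
      ring
  rw [ValuationRing.iff_dvd_total]
  refine ⟨fun x y => ?_⟩
  obtain ⟨a, s, rfl⟩ := IsLocalization.exists_mk'_eq M.primeCompl x
  obtain ⟨b, t, rfl⟩ := IsLocalization.exists_mk'_eq M.primeCompl y
  have hassoc : ∀ (a : D) (s : M.primeCompl),
      Associated (algebraMap D R a) (IsLocalization.mk' R a s) := by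
    intro a s
    have hu := IsLocalization.map_units R s
    refine Associated.symm ⟨hu.unit, ?_⟩
    rw [IsUnit.unit_spec, IsLocalization.mk'_spec]
  rw [← (hassoc a s).dvd_iff_dvd_left, ← (hassoc b t).dvd_iff_dvd_right,
    ← (hassoc b t).dvd_iff_dvd_left, ← (hassoc a s).dvd_iff_dvd_right]
  exact key a b

/-- If the integral ideal `A = I I⁻¹` lay in a maximal `M`, a local generator `a ∈ I` and a common
denominator `s' ∉ M` with `s'I ⊆ aD` would give `s' / a ∈ I⁻¹`, whence `s' ∈ A ⊆ M`. -/
theorem isPruferDomain_of_valuationRing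
    (h : ∀ M : MaximalSpectrum D, ValuationRing (Localization.AtPrime M.asIdeal)) :
    IsPruferDomain D := by
  intro I hI0 hfg
  rw [IsInvertibleIdeal, ← FractionalIdeal.mul_inv_cancel_iff_isUnit]
  set F := FractionRing D
  have hIF : (I : FractionalIdeal D⁰ F) ≠ 0 := FractionalIdeal.coeIdeal_ne_zero.2 hI0
  obtain ⟨A, hA⟩ := FractionalIdeal.le_one_iff_exists_coeIdeal.1
    (FractionalIdeal.mul_one_div_le_one (I := (I : FractionalIdeal D⁰ F)))
  rw [← FractionalIdeal.inv_eq] at hA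
  rw [← hA]
  suffices A = ⊤ by rw [this, FractionalIdeal.coeIdeal_top]
  by_contra hne
  obtain ⟨M, hM, hAM⟩ := Ideal.exists_le_maximal A hne
  have hval : ValuationRing (Localization.AtPrime M) := h ⟨M, hM⟩
  set R := Localization.AtPrime M
  have hinj : Function.Injective (algebraMap D R) :=
    IsLocalization.injective R M.primeCompl_le_nonZeroDivisors
  obtain ⟨T, hT⟩ := hfg
  obtain ⟨g, hg⟩ := (IsBezout.isPrincipal_of_FG _ (Ideal.FG.map ⟨T, hT⟩ (algebraMap D R)))
  have hgI : g ∈ I.map (algebraMap D R) := by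
    rw [hg]
    exact Submodule.mem_span_singleton_self g
  obtain ⟨⟨a, s⟩, has⟩ := (IsLocalization.mem_map_algebraMap_iff M.primeCompl R).1 hgI
  have hex : ∀ t ∈ I, ∃ s ∉ M, ∃ c, s * t = (a : D) * c := by
    intro t ht
    have htI := Ideal.mem_map_of_mem (algebraMap D R) ht
    rw [hg] at htI
    obtain ⟨c, hc⟩ := Submodule.mem_span_singleton.1 htI
    obtain ⟨r, s', rfl⟩ := IsLocalization.exists_mk'_eq M.primeCompl c
    refine ⟨s * s', M.primeCompl.mul_mem s.2 s'.2, r, hinj ?_⟩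
    rw [map_mul, map_mul, map_mul, ← hc, ← has, smul_eq_mul]
    linear_combination g * algebraMap D R s * IsLocalization.mk'_spec R r s'
  -- Finite generation enters here: the denominators of finitely many generators multiply to one
  -- outside `M`.
  have hfin : ∀ T' : Finset D, (∀ t ∈ T', t ∈ I) → ∃ s ∉ M, ∀ t ∈ T', ∃ c, s * t = (a : D) * c := by
    classical
    intro T'
    induction T' using Finset.induction_on with
    | empty => exact fun _ => ⟨1, fun h1 => hM.ne_top ((Ideal.eq_top_iff_one M).2 h1), by simp⟩
    | insert t T' _ ih =>
      intro hT'
      obtain ⟨s₁, hs₁, h₁⟩ := ih fun t' ht' => hT' t' (Finset.mem_insert_of_mem ht')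
      obtain ⟨s₂, hs₂, c, h₂⟩ := hex t (hT' t (Finset.mem_insert_self _ _))
      refine ⟨s₁ * s₂, M.primeCompl.mul_mem hs₁ hs₂, fun t' ht' => ?_⟩
      rcases Finset.mem_insert.1 ht' with rfl | ht'
      · exact ⟨s₁ * c, by rw [mul_assoc, h₂]; ring⟩
      · obtain ⟨c', hc'⟩ := h₁ t' ht'
        exact ⟨s₂ * c', by rw [mul_right_comm, hc']; ring⟩
  obtain ⟨s', hs', hs'T⟩ := hfin T fun t ht => by
    rw [← hT]
    exact Ideal.subset_span ht
  have hall : ∀ t ∈ I, ∃ c, s' * t = (a : D) * c := by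
    intro t ht
    have hle : I ≤ (Ideal.span {(a : D)}).colon {s'} := by
      refine hT.ge.trans (Submodule.span_le.2 fun t ht => ?_)
      obtain ⟨c, hc⟩ := hs'T t ht
      refine Submodule.mem_colon_singleton.2 (Ideal.mem_span_singleton.2 ⟨c, ?_⟩)
      rw [smul_eq_mul, mul_comm, hc]
    obtain ⟨c, hc⟩ := Ideal.mem_span_singleton.1 (Submodule.mem_colon_singleton.1 (hle ht))
    exact ⟨c, by rw [← hc, smul_eq_mul, mul_comm]⟩
  have hs'0 : s' ≠ 0 := by
    rintro rfl
    exact hs' M.zero_mem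
  have ha0 : algebraMap D F a ≠ 0 := by
    intro ha
    have ha : (a : D) = 0 := by simpa using ha
    obtain ⟨t, ht, ht0⟩ := Submodule.exists_mem_ne_zero_of_ne_bot hI0
    obtain ⟨c, hc⟩ := hall t ht
    rw [ha, zero_mul] at hc
    exact mul_ne_zero hs'0 ht0 hc
  have hinv : algebraMap D F s' / algebraMap D F a ∈ (I : FractionalIdeal D⁰ F)⁻¹ := by
    rw [FractionalIdeal.mem_inv_iff hIF]
    intro y hy
    obtain ⟨t, ht, rfl⟩ := (FractionalIdeal.mem_coeIdeal _).1 hy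
    obtain ⟨c, hc⟩ := hall t ht
    refine (FractionalIdeal.mem_one_iff _).2 ⟨c, ?_⟩
    have := congrArg (algebraMap D F) hc
    rw [map_mul, map_mul] at this
    rw [div_mul_eq_mul_div, this, mul_div_cancel_left₀ _ ha0]
  have hmem := FractionalIdeal.mul_mem_mul (FractionalIdeal.mem_coeIdeal_of_mem D⁰ a.2) hinv
  rw [← hA, mul_div_cancel₀ _ ha0] at hmem
  obtain ⟨r, hr, hrs⟩ := (FractionalIdeal.mem_coeIdeal _).1 hmem
  rw [IsFractionRing.injective D F hrs] at hr
  exact hs' (hAM hr)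

theorem isPruferDomain_iff_forall_valuationRing : IsPruferDomain D ↔
    ∀ M : MaximalSpectrum D, ValuationRing (Localization.AtPrime M.asIdeal) :=
  ⟨fun h M => h.valuationRing M.asIdeal, isPruferDomain_of_valuationRing⟩

theorem isDedekindDomain_iff_isNoetherianRing_and_isPruferDomain :
    IsDedekindDomain D ↔ IsNoetherianRing D ∧ IsPruferDomain D := by
  constructor
  · intro h
    refine ⟨inferInstance, fun I hI _ => ?_⟩
    rw [IsInvertibleIdeal, ← FractionalIdeal.mul_inv_cancel_iff_isUnit]
    exact FractionalIdeal.coe_ideal_mul_inv I hI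
  · rintro ⟨h1, h2⟩
    rw [isDedekindDomain_iff_mul_inv_cancel (K := FractionRing D)]
    intro f hf
    rw [FractionalIdeal.mul_inv_cancel_iff_isUnit]
    obtain ⟨a, I, ha, rfl⟩ := FractionalIdeal.exists_eq_spanSingleton_mul f
    have hI : I ≠ ⊥ := by
      rintro rfl
      exact hf (by simp)
    refine IsUnit.mul ?_ (h2 I hI (IsNoetherian.noetherian I))
    rw [← FractionalIdeal.mul_inv_cancel_iff_isUnit]
    exact FractionalIdeal.spanSingleton_mul_inv _ (by simpa using ha)

theorem isNoetherianRing_iff_forall_localization [Finite (MaximalSpectrum D)] :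
    IsNoetherianRing D ↔
      ∀ M : MaximalSpectrum D, IsNoetherianRing (Localization.AtPrime M.asIdeal) := by
  refine ⟨fun h M => IsLocalization.isNoetherianRing M.asIdeal.primeCompl _ h, fun h => ?_⟩
  exact IsNoetherianRing.of_isLocalization_maximal (fun P _ => Localization.AtPrime P)
    fun P hP => h ⟨P, hP⟩

end Prufer

/-! ### From the localizations to `D` -/

section Global

set_option linter.unusedSectionVars false

variable {D K : Type*} [CommRing D] [IsDomain D] [Field K] [Algebra D K] [IsFractionRing D K]

variable (K) in
/-- The overrings, other than the quotient field, of the localization of `D` at `M`. -/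
def overringsAt (M : Ideal D) : Set (Subalgebra D K) :=
  {S | S ≠ ⊤ ∧ ∀ s ∉ M, (algebraMap D K s)⁻¹ ∈ S}

/-- An overring of `D` contains `D_M` exactly when it inverts every element outside `M`. The
localization is replaced by this condition so that overrings at different `M` live in one type. -/
theorem image_restrictScalars_eq_overringsAt (M : Ideal D) [M.IsPrime] (R : Type*) [CommRing R]
    [Algebra D R] [IsLocalization.AtPrime R M] [Algebra R K] [IsScalarTower D R K] :
    Subalgebra.restrictScalars D '' {S : Subalgebra R K | S ≠ ⊤} = overringsAt K M := by
  have hs0 : ∀ s ∉ M, algebraMap D K s ≠ 0 := by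
    intro s hs h0
    have : s = 0 := by simpa using h0
    exact hs (this ▸ M.zero_mem)
  ext S
  constructor
  · rintro ⟨T, hT, rfl⟩
    refine ⟨fun htop => hT (Subalgebra.restrictScalars_injective D ?_), fun s hs => ?_⟩
    · rw [htop, Subalgebra.restrictScalars_top]
    · rw [Subalgebra.mem_restrictScalars]
      have : (algebraMap D K s)⁻¹ =
          algebraMap R K (IsLocalization.mk' R 1 (⟨s, hs⟩ : M.primeCompl)) := by
        refine inv_eq_of_mul_eq_one_left ?_
        rw [IsScalarTower.algebraMap_apply D R K, ← map_mul]
        have := IsLocalization.mk'_spec R (1 : D) (⟨s, hs⟩ : M.primeCompl)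
        rw [this, map_one, map_one]
      rw [this]
      exact T.algebraMap_mem _
  · rintro ⟨hS, hinv⟩
    let T : Subalgebra R K :=
      { S.toSubsemiring with
        algebraMap_mem' := by
          intro r
          obtain ⟨a, s, rfl⟩ := IsLocalization.exists_mk'_eq M.primeCompl r
          have : algebraMap R K (IsLocalization.mk' R a s) =
              algebraMap D K a * (algebraMap D K s)⁻¹ := by
            rw [eq_mul_inv_iff_mul_eq₀ (hs0 s s.2), IsScalarTower.algebraMap_apply D R K s,
              IsScalarTower.algebraMap_apply D R K a, ← map_mul, IsLocalization.mk'_spec]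
          rw [this]
          exact S.mul_mem (S.algebraMap_mem a) (hinv s s.2) }
    have hT : T.restrictScalars D = S := SetLike.ext fun _ => Iff.rfl
    refine ⟨T, fun htop => hS ?_, hT⟩
    rw [← hT, htop, Subalgebra.restrictScalars_top]

theorem overringsAt_of_isMPD (M : Ideal D) [M.IsPrime]
    (h : IsMPD (Localization.AtPrime M)) :
    (∀ S ∈ overringsAt K M, IsLocalRing S) ∧ (overringsAt K M).Finite ∧
      (overringsAt K M).ncard = overringCount (Localization.AtPrime M) := by
  let R := Localization.AtPrime M
  let : Algebra R K := IsLocalization.localizationAlgebraOfSubmonoidLe R K M.primeCompl D⁰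
    M.primeCompl_le_nonZeroDivisors
  have : IsScalarTower D R K := IsLocalization.localization_isScalarTower_of_submonoid_le R K
    M.primeCompl D⁰ M.primeCompl_le_nonZeroDivisors
  have : IsFractionRing R K :=
    IsFractionRing.isFractionRing_of_isDomain_of_isLocalization M.primeCompl R K
  have hdata := h.localMPDData K
  rw [← image_restrictScalars_eq_overringsAt (K := K) M R]
  refine ⟨?_, hdata.finite.image _, ?_⟩
  · rintro _ ⟨S, -, rfl⟩
    exact hdata.isLocalRing S
  · rw [Set.ncard_image_of_injective _ (Subalgebra.restrictScalars_injective D), hdata.ncard]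

/-- The contraction to `D` of the maximal ideal of an overring. -/
theorem exists_prime_of_isLocalRing (S : Subalgebra D K) [IsLocalRing S] (hS : S ≠ ⊤) :
    ∃ P : Ideal D, P.IsPrime ∧ P ≠ ⊥ ∧ ∀ s, s ∉ P ↔ s ≠ 0 ∧ (algebraMap D K s)⁻¹ ∈ S := by
  have hmem : ∀ s : D, s ∉ (IsLocalRing.maximalIdeal S).comap (algebraMap D S) ↔
      s ≠ 0 ∧ (algebraMap D K s)⁻¹ ∈ S := by
    intro s
    rw [Ideal.mem_comap, IsLocalRing.notMem_maximalIdeal]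
    constructor
    · rintro ⟨u, hu⟩
      have h1 : algebraMap D K s * ((u⁻¹ : Sˣ) : S) = 1 := by
        have := congrArg (Subtype.val) u.mul_inv
        rw [hu] at this
        exact this
      refine ⟨?_, ?_⟩
      · rintro rfl
        simp at h1
      · rw [inv_eq_of_mul_eq_one_right h1]
        exact SetLike.coe_mem _
    · rintro ⟨hs, hi⟩
      refine IsUnit.of_mul_eq_one ⟨_, hi⟩ (Subtype.ext ?_)
      exact mul_inv_cancel₀ (by simpa using hs)
  refine ⟨_, Ideal.comap_isPrime _ _, fun h0 => hS ?_, hmem⟩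
  refine S.eq_top_of_forall_inv_mem fun b hb => ((hmem b).1 ?_).2
  rw [h0]
  simpa using hb

/-- Elements outside the contracted prime `P` are inverted in `S`, so any maximal `M ⊇ P` has `D_M ⊆
S`. Conversely, all overrings of a local MPD domain are local. -/
theorem quasiLocalOverrings_eq_insert_iUnion (hD : IsGMPD D) :
    quasiLocalOverrings D K = insert ⊤ (⋃ M : MaximalSpectrum D, overringsAt K M.asIdeal) := by
  ext S
  simp only [Set.mem_insert_iff, Set.mem_iUnion]
  constructor
  · intro hS
    have : IsLocalRing S := hS
    by_cases htop : S = ⊤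
    · exact Or.inl htop
    obtain ⟨P, hP, hP0, hmem⟩ := exists_prime_of_isLocalRing S htop
    obtain ⟨M, hM, -⟩ := hD.1.2 P hP hP0
    exact Or.inr ⟨M, htop, fun s hs => ((hmem s).1 fun h => hs (hM h)).2⟩
  · rintro (rfl | ⟨M, hM⟩)
    · exact Subalgebra.isLocalRing_of_mem_or_inv_mem _ fun _ => Or.inl Algebra.mem_top
    · exact (overringsAt_of_isMPD M.asIdeal (hD.2 M)).1 S hM

/-- If `S` contains `D_M`, its contracted prime lies in `M`; a nonzero prime lies in only one
maximal ideal. -/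
theorem pairwise_disjoint_overringsAt (hD : IsGMPD D) :
    Pairwise (Function.onFun Disjoint fun M : MaximalSpectrum D => overringsAt K M.asIdeal) := by
  intro M M' hne
  rw [Function.onFun, Set.disjoint_left]
  intro S hM hM'
  have := (overringsAt_of_isMPD M.asIdeal (hD.2 M)).1 S hM
  obtain ⟨P, hP, hP0, hmem⟩ := exists_prime_of_isLocalRing S hM.1
  have hle : ∀ N : MaximalSpectrum D, S ∈ overringsAt K N.asIdeal → P ≤ N.asIdeal := by
    intro N hN s hs
    by_contra hsN
    refine (hmem s).2 ⟨?_, hN.2 s hsN⟩ hs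
    rintro rfl
    exact hsN (Ideal.zero_mem _)
  obtain ⟨N, -, huniq⟩ := hD.1.2 P hP hP0
  exact hne ((huniq M (hle M hM)).trans (huniq M' (hle M' hM')).symm)

theorem quasiLocalOverrings_finite_and_ncard (hD : IsGMPD D) [Fintype (MaximalSpectrum D)] :
    (quasiLocalOverrings D K).Finite ∧ (quasiLocalOverrings D K).ncard =
      ∑ M : MaximalSpectrum D, overringCount (Localization.AtPrime M.asIdeal) + 1 := by
  have hM := fun M : MaximalSpectrum D => overringsAt_of_isMPD (K := K) M.asIdeal (hD.2 M)
  have hfin : (⋃ M : MaximalSpectrum D, overringsAt K M.asIdeal).Finite :=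
    Set.finite_iUnion fun M => (hM M).2.1
  rw [quasiLocalOverrings_eq_insert_iUnion hD]
  refine ⟨hfin.insert _, ?_⟩
  rw [Set.ncard_insert_of_notMem ?_ hfin]
  · congr 1
    rw [← Nat.cast_inj (R := ℕ∞), hfin.cast_ncard_eq,
      Set.encard_iUnion_of_finite (pairwise_disjoint_overringsAt hD), finsum_eq_sum_of_fintype,
      Nat.cast_sum]
    refine Finset.sum_congr rfl fun M _ => ?_
    rw [← (hM M).2.2, (hM M).2.1.cast_ncard_eq]
  · simp only [Set.mem_iUnion, not_exists]
    exact fun M h => h.1 rfl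

theorem sum_ite_eq_ncard {ι : Type*} [Fintype ι] (p : ι → Prop) [DecidablePred p] :
    ∑ i, (if p i then 1 else 0) = {i | p i}.ncard := by
  rw [Set.ncard_eq_toFinset_card', ← Finset.card_filter]
  congr 1
  ext
  simp

theorem ncard_eq_zero_iff_forall_not {ι : Type*} [Finite ι] {p : ι → Prop} :
    {i | p i}.ncard = 0 ↔ ∀ i, ¬ p i := by
  rw [Set.ncard_eq_zero, Set.eq_empty_iff_forall_notMem]
  rfl

end Global

/-! ### The main theorem -/

theorem theorem2p8 {D K : Type*} [CommRing D] [IsDomain D] [Field K] [Algebra D K]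
    [IsFractionRing D K] (hD : IsGMPD D) (hfin : Finite (MaximalSpectrum D))
    (n₁ n₂ n₃ n₄ : ℕ)
    (h₁ : {M : MaximalSpectrum D |
      IsTwoGeneratedPVDNotDVR (Localization.AtPrime M.asIdeal)}.ncard = n₁)
    (h₂ : {M : MaximalSpectrum D |
      IsValuationDomainWithGroup (Localization.AtPrime M.asIdeal) ℝ}.ncard = n₂)
    (h₃ : {M : MaximalSpectrum D |
      IsValuationDomainWithGroup (Localization.AtPrime M.asIdeal) (ℤ ×ₗ ℤ)}.ncard = n₃)
    (h₄ : {M : MaximalSpectrum D |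
      IsValuationDomainWithGroup (Localization.AtPrime M.asIdeal) ℤ}.ncard = n₄) :
    ((quasiLocalOverrings D K).Finite ∧
      (quasiLocalOverrings D K).ncard = 2 * (n₁ + n₃) + (n₂ + n₄) + 1) ∧
    (IsNoetherianRing D ↔ (quasiLocalOverrings D K).ncard = 2 * n₁ + n₄ + 1) ∧
    (IsPruferDomain D ↔ (quasiLocalOverrings D K).ncard = 2 * n₃ + (n₂ + n₄) + 1) ∧
    (IsDedekindDomain D ↔ (quasiLocalOverrings D K).ncard = n₄ + 1) := by
  have := Fintype.ofFinite (MaximalSpectrum D)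
  obtain ⟨hfinite, hcard⟩ := quasiLocalOverrings_finite_and_ncard (K := K) hD
  have hsum : ∑ M : MaximalSpectrum D, overringCount (Localization.AtPrime M.asIdeal) =
      2 * (n₁ + n₃) + (n₂ + n₄) := by
    simp only [overringCount, Finset.sum_add_distrib, ← Finset.mul_sum, sum_ite_eq_ncard,
      h₁, h₂, h₃, h₄]
  rw [hsum] at hcard
  have hnoeth : IsNoetherianRing D ↔ n₂ = 0 ∧ n₃ = 0 := by
    rw [isNoetherianRing_iff_forall_localization, ← h₂, ← h₃, ncard_eq_zero_iff_forall_not,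
      ncard_eq_zero_iff_forall_not, ← forall_and]
    exact forall_congr' fun M => (hD.2 M).isNoetherianRing_iff
  have hprufer : IsPruferDomain D ↔ n₁ = 0 := by
    rw [isPruferDomain_iff_forall_valuationRing, ← h₁, ncard_eq_zero_iff_forall_not]
    exact forall_congr' fun M => (hD.2 M).valuationRing_iff
  rw [isDedekindDomain_iff_isNoetherianRing_and_isPruferDomain, hnoeth, hprufer, hcard]
  -- Given the count, the equations in (b), (c), (d) say `2n₃ + n₂ = 0`, `2n₁ = 0` and `2(n₁ + n₃) +
  -- n₂ = 0`.
  refine ⟨⟨hfinite, rfl⟩, ?_, ?_, ?_⟩ <;> omega
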